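/- Let $U\in C^2(\mathbb C;\mathbb R)$ (in the real sense) satisfy $U(z)=u(|z|^2)$ for some $u:\mathbb R\to\mathbb R$ and $U(z)\ge A-B|z|^2$ for all $z\in\mathbb C$, with some $A\in\mathbb R$, $B>0$. Let $F=-\nabla U$, where $\nabla U=\partial_{\mathrm{Re}\,z}U+i\,\partial_{\mathrm{Im}\,z}U$. Let $\phi\in H^1(\mathbb R)$ and let $\psi\in C(\mathbb R,H^1(\mathbb R))$ be the global solution, in the sense of distributions on $\mathbb R\times\mathbb R$, of $$i\,\partial_t\psi(x,t)=-\partial_x^2\psi(x,t)-\delta(x)F(\psi(0,t)),\qquad \psi(\cdot,0)=\phi,$$ where for each $t$ the function $x\mapsto\psi(x,t)$ is taken to be the continuous representative of its class in $H^1(\mathbb R)$. Then $\psi$ belongs to the Hölder space $C^{1/4}(\mathbb R\times\mathbb R)$: it is bounded on $\mathbb R\times\mathbb R$, and there is a constant $C<\infty$ such that $$|\psi(x,t)-\psi(x',t')|\le C\,\max(|x-x'|,|t-t'|)^{1/4}\qquad\text{for all }(x,t),(x',t')\in\mathbb R\times\mathbb R .$$ -/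

import Mathlib

open MeasureTheory
open scoped ENNReal NNReal ContDiff

noncomputable section

/-- Complex-valued square integrable functions on the line. -/
abbrev L2 : Type := Lp ℂ 2 (volume : Measure ℝ)

/-- The function `g` is the weak (distributional) derivative of `f`. -/
def HasWeakDeriv (f g : L2) : Prop :=
  ∀ χ : ℝ → ℂ, ContDiff ℝ ∞ χ → HasCompactSupport χ →
    ∫ x, f x * deriv χ x = -∫ x, g x * χ x

theorem integrable_L2_mul (f : L2) {χ : ℝ → ℂ} (hc : Continuous χ) (hs : HasCompactSupport χ) :
    Integrable (fun x => f x * χ x) :=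
  (Lp.memLp f).integrable_mul (q := 2) (hc.memLp_of_hasCompactSupport hs)

/-- The Sobolev space `H¹(ℝ)`: square integrable functions with a square integrable weak
derivative, realised as the space of pairs `(f, f')`, with
`‖(f, f')‖² = ‖f‖²_{L²} + ‖f'‖²_{L²}`. -/
def H1 : Submodule ℂ (WithLp 2 (L2 × L2)) where
  carrier := {p | HasWeakDeriv p.fst p.snd}
  zero_mem' := by
    intro χ _ _
    have h : ∀ η : ℝ → ℂ, ∫ x, (0 : L2) x * η x = 0 := fun η => by
      rw [integral_congr_ae (g := fun _ => (0 : ℂ)), integral_zero]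
      filter_upwards [Lp.coeFn_zero ℂ 2 (volume : Measure ℝ)] with x hx
      rw [hx, Pi.zero_apply, zero_mul]
    simp only [WithLp.zero_fst, WithLp.zero_snd, h, neg_zero]
  add_mem' := by
    intro p q hp hq χ hχ hs
    have h : ∀ (f g : L2) (η : ℝ → ℂ), Continuous η → HasCompactSupport η →
        ∫ x, (f + g : L2) x * η x = (∫ x, f x * η x) + ∫ x, g x * η x := by
      intro f g η hη hsη
      rw [← integral_add (integrable_L2_mul f hη hsη) (integrable_L2_mul g hη hsη)]
      apply integral_congr_ae
      filter_upwards [Lp.coeFn_add f g] with x hx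
      rw [hx, Pi.add_apply, add_mul]
    simp only [WithLp.add_fst, WithLp.add_snd]
    rw [h _ _ _ (hχ.continuous_deriv (by simp)) hs.deriv, h _ _ _ hχ.continuous hs,
      hp χ hχ hs, hq χ hχ hs]
    ring
  smul_mem' := by
    intro c p hp χ hχ hs
    have h : ∀ (f : L2) (η : ℝ → ℂ), ∫ x, (c • f : L2) x * η x = c * ∫ x, f x * η x := by
      intro f η
      rw [← integral_const_mul]
      apply integral_congr_ae
      filter_upwards [Lp.coeFn_smul c f] with x hx
      rw [hx, Pi.smul_apply, smul_eq_mul, mul_assoc]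
    simp only [WithLp.smul_fst, WithLp.smul_snd]
    rw [h, h, hp χ hχ hs, mul_neg]

/-- The function `v : ℝ → ℂ` is the continuous representative of the class `f ∈ H¹(ℝ)`. -/
def IsContinuousRep (v : ℝ → ℂ) (f : H1) : Prop :=
  Continuous v ∧ v =ᵐ[volume] (f : WithLp 2 (L2 × L2)).fst

/-- `i ψ_t = -ψ_xx - δ(x) F(ψ(0,t))` on `ℝ × ℝ` in the sense of distributions. Arguments of `ψ`
and of the test functions are in the order `(x, t)`. -/
def SolvesNLS (F : ℂ → ℂ) (ψ : ℝ × ℝ → ℂ) : Prop :=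
  ∀ χ : ℝ × ℝ → ℂ, ContDiff ℝ ∞ χ → HasCompactSupport χ →
    ∫ t : ℝ, ∫ x : ℝ, ψ (x, t) * (-(Complex.I * deriv (fun s : ℝ => χ (x, s)) t)) =
      (∫ t : ℝ, ∫ x : ℝ, ψ (x, t) * -(iteratedDeriv 2 (fun y : ℝ => χ (y, t)) x))
        - ∫ t : ℝ, F (ψ (0, t)) * χ (0, t)

/-- `ψ` is a global solution of class `C(ℝ, H¹(ℝ))` of `i ψ_t = -ψ_xx - δ(x) F(ψ(0,t))`
with `ψ(·, 0) = φ`; at each time its values are those of the continuous representative. -/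
structure IsGlobalSolution (F : ℂ → ℂ) (φ : H1) (ψ : ℝ × ℝ → ℂ) : Prop where
  continuous_H1 : ∃ Ψ : ℝ → H1, Continuous Ψ ∧ Ψ 0 = φ ∧
    ∀ t : ℝ, IsContinuousRep (fun x => ψ (x, t)) (Ψ t)
  equation : SolvesNLS F ψ

end

open MeasureTheory
open scoped ENNReal NNReal ContDiff ComplexConjugate

noncomputable section

/-! Everything rests on a bound of `Ψ t` in `H1` that is uniform in time. Given it, Cauchy-Schwarz
makes the solution Hölder 1/2 in space. Testing the equation with an increment gives `‖ψ(t) -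
ψ(t')‖² ≤ C |t - t'|` in `L2`. The interpolation of sup norms between `L2` and `H1`
(`IsContinuousRep.sqrt_mul_norm_le`) turns this into the exponent 1/4 in time.

The uniform bound comes from conservation of charge and energy, because a quadratic lower bound on
`U` at one point is absorbed by half of the kinetic energy and the charge. Charge is conserved
because rotation invariance makes `F z * conj z` real.

Conservation of energy is the hard part. Formally one pairs `F(y)` with `y'`, where `y(t) = ψ(0,
t)`, but for a solution merely continuous into `H1` the trace `y` need not be differentiable. The
path is therefore replaced by its Steklov averages `h⁻¹ ∫_t^{t+h}`. The energy of the averages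
changes at the rate given by pairing the commutator `avg F(y) - F(avg y)` with `h⁻¹ (y(t+h) -
y(t))`. As `F` is locally Lipschitz, the total change is at most a constant times `h⁻¹ sup_{r ≤ h} ∫
|y(t+r) - y(t)|² dt`. So conservation follows if the mean square increments of the trace are `o(h)`;
pointwise interpolation would give only `o(h^{1/2})`.

That gain is a hidden regularity estimate (`WeakSolution.integral_trace_increment_le`), proved by a
momentum multiplier. For the even part `e` of an increment, on `(0, 1]`, the time derivative of a
momentum with weight `(1 - x)²` produces `-|e(0)|²` plus terms controlled by `L2` norms. Since `e`
has no time derivative in `L2`, the momentum pairs `e` with its spatial primitive `V`, built from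
the time integral of the spatial derivative, and `V` is differentiable in time. -/

/-! ### Weak derivatives, primitives and the product rule -/

/-- A smooth compactly supported function of vanishing integral is the derivative of a smooth
compactly supported function. -/
theorem exists_smooth_primitive {σ : ℝ → ℝ} (hσ : ContDiff ℝ ∞ σ) (hc : HasCompactSupport σ)
    (h0 : ∫ x, σ x = 0) :
    ∃ θ : ℝ → ℝ, ContDiff ℝ ∞ θ ∧ HasCompactSupport θ ∧ deriv θ = σ := by
  obtain ⟨R, hR⟩ := hc.isCompact.isBounded.subset_closedBall 0
  have hz : ∀ x, R < |x| → σ x = 0 := by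
    intro x hx
    by_contra h
    have := hR (subset_tsupport σ h)
    rw [mem_closedBall_zero_iff, Real.norm_eq_abs] at this
    linarith
  set A : ℝ := -|R| - 1 with hA
  have hd : ∀ x, HasDerivAt (fun x => ∫ t in A..x, σ t) (σ x) x := fun x =>
    hσ.continuous.integral_hasStrictDerivAt _ x |>.hasDerivAt
  have hderiv : deriv (fun x => ∫ t in A..x, σ t) = σ := funext fun x => (hd x).deriv
  refine ⟨fun x => ∫ t in A..x, σ t, ?_, ?_, hderiv⟩
  · rw [contDiff_infty_iff_deriv, hderiv]
    exact ⟨fun x => (hd x).differentiableAt, hσ⟩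
  · refine HasCompactSupport.of_support_subset_isCompact (isCompact_Icc (a := A) (b := |R|)) ?_
    intro x hx
    by_contra hx'
    apply hx
    rw [Set.mem_Icc, not_and_or, not_le, not_le] at hx'
    have key : ∀ s : Set ℝ, MeasurableSet s → (∀ t ∈ s, |R| < |t|) → ∫ t in s, σ t = 0 := by
      intro s hm hs
      rw [setIntegral_congr_fun hm (g := fun _ => 0), integral_zero]
      exact fun t ht => hz t ((le_abs_self R).trans_lt (hs t ht))
    rcases hx' with hx' | hx'
    · simp only
      rw [intervalIntegral.integral_of_ge hx'.le, key _ measurableSet_Ioc, neg_zero]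
      intro t ht
      have := ht.2
      have h1 := neg_abs_le t
      linarith
    · simp only
      have hint : Integrable σ := hσ.continuous.integrable_of_hasCompactSupport hc
      rw [intervalIntegral.integral_of_le (by linarith [abs_nonneg R])]
      have h1 : (∫ t in Set.Ioc A x, σ t) + ∫ t in (Set.Ioc A x)ᶜ, σ t = 0 := by
        rw [integral_add_compl measurableSet_Ioc hint, h0]
      rw [key _ measurableSet_Ioc.compl, add_zero] at h1
      · exact h1
      · intro t ht
        simp only [Set.mem_compl_iff, Set.mem_Ioc, not_and_or, not_lt, not_le] at ht
        rcases ht with h | h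
        · have := neg_abs_le t
          linarith
        · exact hx'.trans (h.trans_le (le_abs_self t))

/-- A locally integrable function with vanishing weak derivative is almost everywhere constant. -/
theorem ae_const_of_weak_deriv_zero {c : ℝ → ℂ} (hc : LocallyIntegrable c volume)
    (h : ∀ θ : ℝ → ℂ, ContDiff ℝ ∞ θ → HasCompactSupport θ → ∫ x, c x * deriv θ x = 0) :
    ∃ k : ℂ, c =ᵐ[volume] fun _ => k := by
  let b : ContDiffBump (0 : ℝ) := ⟨1, 2, one_pos, one_lt_two⟩
  set ρ : ℝ → ℝ := b.normed volume with hρ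
  have hρs : ContDiff ℝ ∞ ρ := b.contDiff_normed
  have hρc : HasCompactSupport ρ := b.hasCompactSupport_normed
  have hρ1 : ∫ x, ρ x = 1 := b.integral_normed
  have hi : ∀ g : ℝ → ℝ, ContDiff ℝ ∞ g → HasCompactSupport g →
      Integrable (fun x => g x • c x) := fun g hg hgc =>
    hc.integrable_smul_left_of_hasCompactSupport hg.continuous hgc
  refine ⟨∫ x, ρ x • c x, ?_⟩
  set k := ∫ x, ρ x • c x with hk
  have hck : LocallyIntegrable (fun x => c x - k) volume := hc.sub (locallyIntegrable_const k)
  have := ae_eq_zero_of_integral_contDiff_smul_eq_zero hck ?_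
  · filter_upwards [this] with x hx using sub_eq_zero.mp hx
  intro g hg hgc
  have hgi : Integrable g := hg.continuous.integrable_of_hasCompactSupport hgc
  have hρi : Integrable ρ := hρs.continuous.integrable_of_hasCompactSupport hρc
  set m := ∫ x, g x with hm
  -- Removing the mean of `g` with the unit bump `ρ` leaves the derivative of a test function, on
  -- which `c` vanishes by hypothesis. Hence `∫ g c = m k`.
  obtain ⟨θ, hθ, hθc, hθd⟩ := exists_smooth_primitive (σ := fun x => g x - m * ρ x)
    (hg.sub (contDiff_const.mul hρs)) (hgc.sub hρc.mul_left) (by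
      rw [integral_sub hgi (hρi.const_mul _), integral_const_mul, hρ1, mul_one, sub_self])
  have h1 := h (fun x => (θ x : ℂ)) (Complex.ofRealCLM.contDiff.comp hθ)
    (hθc.comp_left (g := fun x : ℝ => (x : ℂ)) Complex.ofReal_zero)
  have h2 : ∀ x, deriv (fun x => (θ x : ℂ)) x = ((g x - m * ρ x : ℝ) : ℂ) := by
    intro x
    have : HasDerivAt θ (g x - m * ρ x) x := by
      have := (hθ.differentiable (by simp) x).hasDerivAt
      rwa [hθd] at this
    exact this.ofReal_comp.deriv
  simp only [h2] at h1
  calc ∫ x, g x • (c x - k) = (∫ x, g x • c x) - ∫ x, g x • k := by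
        rw [← integral_sub (hi g hg hgc) (hgi.smul_const k)]
        simp only [smul_sub]
    _ = (∫ x, g x • c x) - m • k := by rw [integral_smul_const]
    _ = ∫ x, c x * ((g x - m * ρ x : ℝ) : ℂ) := by
        rw [hk, ← integral_smul]
        refine (integral_sub (hi g hg hgc) ((hi ρ hρs hρc).smul m)).symm.trans ?_
        congr 1
        ext x
        simp only [Complex.real_smul, Pi.smul_apply]
        push_cast
        ring
    _ = 0 := h1

/-- Increments of the primitive are dominated by those of the real primitive of `‖g‖`, which reduces
the complex case to the real one. -/
theorem absolutelyContinuousOnInterval_primitive {g : ℝ → ℂ} {a b : ℝ}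
    (hg : IntervalIntegrable g volume a b) :
    AbsolutelyContinuousOnInterval (fun x => ∫ t in a..x, g t) a b := by
  have hn := hg.norm.absolutelyContinuousOnInterval_intervalIntegral (c := a) (by simp)
  unfold AbsolutelyContinuousOnInterval at hn ⊢
  refine squeeze_zero' (Filter.Eventually.of_forall fun _ =>
    Finset.sum_nonneg fun i _ => dist_nonneg) ?_ hn
  rw [Filter.eventually_inf_principal]
  filter_upwards with ⟨n, I⟩ hI
  refine Finset.sum_le_sum fun i hi => ?_
  have hI1 := hI.1 i hi
  have hs : ∀ x ∈ Set.uIcc a b, IntervalIntegrable g volume a x := fun x hx =>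
    hg.mono_set (Set.uIcc_subset_uIcc_left hx)
  rw [dist_eq_norm, dist_eq_norm,
    intervalIntegral.integral_interval_sub_left (hs _ hI1.1) (hs _ hI1.2),
    intervalIntegral.integral_interval_sub_left (hs _ hI1.1).norm (hs _ hI1.2).norm]
  exact intervalIntegral.norm_integral_le_abs_integral_norm.trans
    (le_of_eq (Real.norm_eq_abs _).symm)

/-- Product rule for absolutely continuous functions. -/
theorem integral_product_rule {u v u' v' : ℝ → ℂ} {a b : ℝ}
    (hu' : IntervalIntegrable u' volume a b) (hv' : IntervalIntegrable v' volume a b)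
    (hu : ∀ x ∈ Set.uIcc a b, u x = u a + ∫ t in a..x, u' t)
    (hv : ∀ x ∈ Set.uIcc a b, v x = v a + ∫ t in a..x, v' t) :
    ∫ x in a..b, (u' x * v x + u x * v' x) = u b * v b - u a * v a := by
  have ac_const : ∀ k : ℂ, AbsolutelyContinuousOnInterval (fun _ : ℝ => k) a b := fun k =>
    (contDiffOn_const (c := k)).absolutelyContinuousOnInterval
  set U : ℝ → ℂ := fun x => u a + ∫ t in a..x, u' t with hU
  set V : ℝ → ℂ := fun x => v a + ∫ t in a..x, v' t with hV
  have hUac : AbsolutelyContinuousOnInterval U a b :=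
    (ac_const _).fun_add (absolutelyContinuousOnInterval_primitive hu')
  have hVac : AbsolutelyContinuousOnInterval V a b :=
    (ac_const _).fun_add (absolutelyContinuousOnInterval_primitive hv')
  have hI : IntervalIntegrable (fun x => u' x * V x + U x * v' x) volume a b :=
    (hu'.mul_continuousOn hVac.continuousOn).add (hv'.continuousOn_mul hUac.continuousOn)
  -- The product minus the integral of its formal derivative is absolutely continuous with
  -- derivative zero almost everywhere, hence constant.
  have hac := (hUac.fun_smul hVac).fun_sub (absolutelyContinuousOnInterval_primitive hI)
  obtain ⟨C, hC⟩ := hac.const_of_ae_hasDerivAt_zero (by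
    filter_upwards [hu'.ae_hasDerivAt_integral, hv'.ae_hasDerivAt_integral,
      hI.ae_hasDerivAt_integral] with x h1 h2 h3 hx
    have e1 := (h1 hx a (by simp)).const_add (u a)
    have e2 := (h2 hx a (by simp)).const_add (v a)
    have e3 := h3 hx a (by simp)
    have e4 := (e1.mul e2).sub e3
    simp only [hU, hV, sub_self] at e4
    exact e4)
  have ha := hC a (by simp)
  have hb := hC b (by simp)
  have hUV : ∫ x in a..b, (u' x * v x + u x * v' x) = ∫ x in a..b, (u' x * V x + U x * v' x) := by
    refine intervalIntegral.integral_congr fun x hx => ?_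
    simp only [hU, hV]
    rw [← hu x hx, ← hv x hx]
  have e1 : U a = u a := by simp [hU]
  have e2 : V a = v a := by simp [hV]
  have e3 : U b = u b := (hu b (by simp)).symm
  have e4 : V b = v b := (hv b (by simp)).symm
  rw [hUV]
  simp only [smul_eq_mul, e1, e2, e3, e4, intervalIntegral.integral_same, sub_zero] at ha hb
  rw [ha, ← hb]
  ring

theorem contDiff_primitive_identity {θ : ℝ → ℂ} (hθ : ContDiff ℝ ∞ θ) (a x : ℝ) :
    θ x = θ a + ∫ t in a..x, deriv θ t := by
  rw [intervalIntegral.integral_deriv_eq_sub (fun y _ => hθ.differentiable (by simp) y)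
    ((hθ.continuous_deriv (by simp)).intervalIntegrable _ _)]
  ring

/-- Integration by parts of a primitive against a test function. -/
theorem integral_primitive_mul_deriv {g : ℝ → ℂ} (hg : LocallyIntegrable g volume)
    {θ : ℝ → ℂ} (hθ : ContDiff ℝ ∞ θ) (hc : HasCompactSupport θ) :
    ∫ x, (∫ t in (0 : ℝ)..x, g t) * deriv θ x = -∫ x, g x * θ x := by
  have hgi : ∀ a b, IntervalIntegrable g volume a b := fun _ _ =>
    (hg.integrableOn_isCompact isCompact_uIcc).intervalIntegrable
  obtain ⟨R, hR⟩ := hc.isCompact.isBounded.subset_closedBall 0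
  have hz : ∀ x ∉ Set.Ioc (-(|R| + 1)) (|R| + 1), θ x = 0 ∧ deriv θ x = 0 := by
    intro x hx
    have hx' : x ∉ tsupport θ := fun h => hx (by
      have := hR h
      rw [mem_closedBall_zero_iff, Real.norm_eq_abs, abs_le] at this
      constructor <;> linarith [le_abs_self R])
    exact ⟨image_eq_zero_of_notMem_tsupport hx',
      image_eq_zero_of_notMem_tsupport fun h => hx' (tsupport_deriv_subset h)⟩
  have hle : -(|R| + 1) ≤ |R| + 1 := by linarith [abs_nonneg R]
  have hcut : ∀ F : ℝ → ℂ, (∀ x ∉ Set.Ioc (-(|R| + 1)) (|R| + 1), F x = 0) →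
      ∫ x, F x = ∫ x in (-(|R| + 1))..(|R| + 1), F x := by
    intro F hF
    rw [intervalIntegral.integral_of_le hle, setIntegral_eq_integral_of_forall_compl_eq_zero hF]
  have hd : IntervalIntegrable (deriv θ) volume (-(|R| + 1)) (|R| + 1) :=
    (hθ.continuous_deriv (by simp)).intervalIntegrable _ _
  have key := integral_product_rule (u := fun x => ∫ t in (0 : ℝ)..x, g t) (v := θ) (u' := g)
    (v' := deriv θ) (hgi (-(|R| + 1)) (|R| + 1)) hd
    (fun x _ => (intervalIntegral.integral_add_adjacent_intervals (hgi _ _) (hgi _ _)).symm)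
    (fun x _ => contDiff_primitive_identity hθ _ x)
  have hp : Continuous fun x => ∫ t in (0 : ℝ)..x, g t :=
    intervalIntegral.continuous_primitive hgi 0
  have z1 : θ (-(|R| + 1)) = 0 := (hz _ (by simp)).1
  have z2 : θ (|R| + 1) = 0 := by
    refine image_eq_zero_of_notMem_tsupport fun h => ?_
    have := hR h
    rw [mem_closedBall_zero_iff, Real.norm_eq_abs, abs_le] at this
    linarith [le_abs_self R]
  rw [intervalIntegral.integral_add ((hgi _ _).mul_continuousOn hθ.continuous.continuousOn)
    (hd.continuousOn_mul hp.continuousOn), z1, z2] at key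
  rw [hcut _ fun x hx => by rw [(hz x hx).2, mul_zero], hcut _ fun x hx => by
    rw [(hz x hx).1, mul_zero]]
  linear_combination key

theorem locallyIntegrable_primitive {g : ℝ → ℂ} (hg : LocallyIntegrable g volume) :
    Continuous fun x => ∫ t in (0 : ℝ)..x, g t :=
  intervalIntegral.continuous_primitive
    (fun _ _ => (hg.integrableOn_isCompact isCompact_uIcc).intervalIntegrable) 0

/-- A function with locally integrable weak derivative is a primitive of it. -/
theorem ae_eq_primitive_of_weak_deriv {v g : ℝ → ℂ} (hv : LocallyIntegrable v volume)
    (hg : LocallyIntegrable g volume)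
    (h : ∀ θ : ℝ → ℂ, ContDiff ℝ ∞ θ → HasCompactSupport θ →
      ∫ x, v x * deriv θ x = -∫ x, g x * θ x) :
    ∃ k : ℂ, v =ᵐ[volume] fun x => k + ∫ t in (0 : ℝ)..x, g t := by
  have hp := locallyIntegrable_primitive hg
  obtain ⟨k, hk⟩ := ae_const_of_weak_deriv_zero (c := fun x => v x - ∫ t in (0 : ℝ)..x, g t)
    (hv.sub hp.locallyIntegrable) fun θ hθ hc => by
      have hdc : Continuous (deriv θ) := hθ.continuous_deriv (by simp)
      simp only [sub_mul]
      rw [integral_sub, h θ hθ hc, integral_primitive_mul_deriv hg hθ hc, sub_self]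
      · exact hv.integrable_smul_right_of_hasCompactSupport hdc hc.deriv
      · exact hp.locallyIntegrable.integrable_smul_right_of_hasCompactSupport hdc hc.deriv
  refine ⟨k, ?_⟩
  filter_upwards [hk] with x hx
  rw [← hx]
  ring

/-- The du Bois-Reymond lemma for continuous functions. -/
theorem sub_eq_integral_of_weak_deriv {v g : ℝ → ℂ} (hv : Continuous v)
    (hg : LocallyIntegrable g volume)
    (h : ∀ θ : ℝ → ℂ, ContDiff ℝ ∞ θ → HasCompactSupport θ →
      ∫ x, v x * deriv θ x = -∫ x, g x * θ x) (a b : ℝ) :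
    v b - v a = ∫ t in a..b, g t := by
  obtain ⟨k, hk⟩ := ae_eq_primitive_of_weak_deriv hv.locallyIntegrable hg h
  have hk' := (hv.ae_eq_iff_eq volume
    (continuous_const.add (locallyIntegrable_primitive hg))).mp hk
  have hgi : ∀ a b, IntervalIntegrable g volume a b := fun _ _ =>
    (hg.integrableOn_isCompact isCompact_uIcc).intervalIntegrable
  rw [hk']
  simp only [Pi.add_apply, add_sub_add_left_eq_sub]
  exact intervalIntegral.integral_interval_sub_left (hgi _ _) (hgi _ _)

/-! ### Estimates in `L2` and the embedding of `H1` into continuous functions -/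

theorem L2.locallyIntegrable (f : L2) : LocallyIntegrable f volume :=
  (Lp.memLp f).locallyIntegrable (by norm_num)

theorem L2.intervalIntegrable (f : L2) (a b : ℝ) : IntervalIntegrable f volume a b :=
  ((L2.locallyIntegrable f).integrableOn_isCompact isCompact_uIcc).intervalIntegrable

theorem L2.norm_sq_eq_integral (f : L2) : ‖f‖ ^ 2 = ∫ x, ‖f x‖ ^ 2 := by
  have h := inner_self_eq_norm_sq_to_K (𝕜 := ℂ) f
  rw [MeasureTheory.L2.inner_def] at h
  simp only [inner_self_eq_norm_sq_to_K] at h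
  have h2 : (∫ a, ((‖f a‖ : ℂ)) ^ 2) = ((∫ x, ‖f x‖ ^ 2 : ℝ) : ℂ) := by
    rw [← integral_complex_ofReal]
    simp
  have h3 : ((∫ x, ‖f x‖ ^ 2 : ℝ) : ℂ) = (‖f‖ : ℂ) ^ 2 := h2.symm.trans h
  exact_mod_cast h3.symm

theorem L2.integrable_norm_sq (f : L2) : Integrable fun x => ‖f x‖ ^ 2 :=
  (Lp.memLp f).integrable_norm_pow (by norm_num)

/-- The Cauchy-Schwarz inequality on an interval. -/
theorem L2.integral_norm_le (f : L2) {a b : ℝ} (hab : a ≤ b) :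
    ∫ x in a..b, ‖f x‖ ≤ √(b - a) * ‖f‖ := by
  rcases hab.eq_or_lt with rfl | hlt
  · simp
  have hint : IntervalIntegrable (fun x => ‖f x‖) volume a b := (L2.intervalIntegrable f a b).norm
  have hsq : IntervalIntegrable (fun x => ‖f x‖ ^ 2) volume a b :=
    (L2.integrable_norm_sq f).intervalIntegrable
  have hle : ∫ x in a..b, ‖f x‖ ^ 2 ≤ ‖f‖ ^ 2 := by
    rw [L2.norm_sq_eq_integral, intervalIntegral.integral_of_le hab]
    exact setIntegral_le_integral (L2.integrable_norm_sq f)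
      (Filter.Eventually.of_forall fun x => by positivity)
  -- Cauchy-Schwarz is read off from the nonnegativity of the variance of `‖f‖` about its mean `m /
  -- (b - a)`.
  set m := ∫ x in a..b, ‖f x‖ with hm
  have hb : 0 < b - a := sub_pos.mpr hlt
  have hpos : 0 ≤ ∫ x in a..b, (‖f x‖ - m / (b - a)) ^ 2 :=
    intervalIntegral.integral_nonneg hab fun x _ => sq_nonneg _
  have hexp : ∫ x in a..b, (‖f x‖ - m / (b - a)) ^ 2 =
      (∫ x in a..b, ‖f x‖ ^ 2) - m ^ 2 / (b - a) := by
    have : ∀ x, (‖f x‖ - m / (b - a)) ^ 2 =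
        ‖f x‖ ^ 2 - (2 * (m / (b - a))) * ‖f x‖ + (m / (b - a)) ^ 2 := fun x => by ring
    simp only [this]
    rw [intervalIntegral.integral_add (hsq.sub (hint.const_mul _)) (by simp),
      intervalIntegral.integral_sub hsq (hint.const_mul _), intervalIntegral.integral_const_mul,
      intervalIntegral.integral_const, ← hm, smul_eq_mul]
    field_simp
    ring
  have h1 : m ^ 2 ≤ (b - a) * ‖f‖ ^ 2 := by
    have : m ^ 2 / (b - a) ≤ ‖f‖ ^ 2 := by linarith
    rw [div_le_iff₀ hb] at this
    linarith
  calc m ≤ √(m ^ 2) := Real.le_sqrt_of_sq_le le_rfl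
    _ ≤ √((b - a) * ‖f‖ ^ 2) := Real.sqrt_le_sqrt h1
    _ = √(b - a) * ‖f‖ := by rw [Real.sqrt_mul hb.le, Real.sqrt_sq (norm_nonneg _)]

/-- The underlying function of an element of `H¹`. -/
def fnL : H1 →L[ℂ] L2 := (WithLp.fstL 2 ℂ L2 L2).comp H1.subtypeL

/-- The weak derivative of an element of `H¹`. -/
def derL : H1 →L[ℂ] L2 := (WithLp.sndL 2 ℂ L2 L2).comp H1.subtypeL

theorem fnL_apply (Φ : H1) : fnL Φ = (Φ : WithLp 2 (L2 × L2)).fst := rfl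

theorem weak_derL (Φ : H1) {θ : ℝ → ℂ} (hθ : ContDiff ℝ ∞ θ) (hc : HasCompactSupport θ) :
    ∫ x, fnL Φ x * deriv θ x = -∫ x, derL Φ x * θ x := Φ.2 θ hθ hc

theorem IsContinuousRep.weak {v : ℝ → ℂ} {Φ : H1} (h : IsContinuousRep v Φ) {θ : ℝ → ℂ}
    (hθ : ContDiff ℝ ∞ θ) (hc : HasCompactSupport θ) :
    ∫ x, v x * deriv θ x = -∫ x, derL Φ x * θ x := by
  rw [← weak_derL Φ hθ hc]
  refine integral_congr_ae ?_
  filter_upwards [h.2] with x hx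
  rw [hx, fnL_apply]

theorem IsContinuousRep.sub_eq_integral {v : ℝ → ℂ} {Φ : H1} (h : IsContinuousRep v Φ) (a b : ℝ) :
    v b - v a = ∫ t in a..b, derL Φ t :=
  sub_eq_integral_of_weak_deriv h.1 (L2.locallyIntegrable _) (fun _ hθ hc => h.weak hθ hc) a b

theorem IsContinuousRep.sub {v w : ℝ → ℂ} {Φ Θ : H1} (h : IsContinuousRep v Φ)
    (h' : IsContinuousRep w Θ) : IsContinuousRep (fun x => v x - w x) (Φ - Θ) := by
  refine ⟨h.1.sub h'.1, ?_⟩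
  filter_upwards [h.2, h'.2, Lp.coeFn_sub (fnL Φ) (fnL Θ)] with x h1 h2 h3
  rw [h1, h2]
  exact h3.symm

theorem IsContinuousRep.add {v w : ℝ → ℂ} {Φ Θ : H1} (h : IsContinuousRep v Φ)
    (h' : IsContinuousRep w Θ) : IsContinuousRep (fun x => v x + w x) (Φ + Θ) := by
  refine ⟨h.1.add h'.1, ?_⟩
  filter_upwards [h.2, h'.2, Lp.coeFn_add (fnL Φ) (fnL Θ)] with x h1 h2 h3
  rw [h1, h2]
  exact h3.symm

theorem IsContinuousRep.norm_sub_le_of_le {v : ℝ → ℂ} {Φ : H1} (h : IsContinuousRep v Φ) {a b : ℝ}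
    (hab : a ≤ b) : ‖v b - v a‖ ≤ √(b - a) * ‖derL Φ‖ := by
  rw [h.sub_eq_integral]
  exact (intervalIntegral.norm_integral_le_integral_norm hab).trans (L2.integral_norm_le _ hab)

theorem IsContinuousRep.norm_sub_le {v : ℝ → ℂ} {Φ : H1} (h : IsContinuousRep v Φ) (a b : ℝ) :
    ‖v b - v a‖ ≤ √|b - a| * ‖derL Φ‖ := by
  rcases le_total a b with hab | hab
  · rw [abs_of_nonneg (sub_nonneg.mpr hab)]
    exact h.norm_sub_le_of_le hab
  · rw [abs_sub_comm, abs_of_nonneg (sub_nonneg.mpr hab), norm_sub_rev]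
    exact h.norm_sub_le_of_le hab

/-- Interpolated form of the embedding of `H¹` into bounded functions. -/
theorem IsContinuousRep.sqrt_mul_norm_le {v : ℝ → ℂ} {Φ : H1} (h : IsContinuousRep v Φ) (x : ℝ)
    {l : ℝ} (hl : 0 < l) : √l * ‖v x‖ ≤ ‖fnL Φ‖ + l * ‖derL Φ‖ := by
  -- The value at `x` is compared with the values on an interval of length `l`, and the inequality
  -- is then averaged over that interval.
  have h1 : ∀ z ∈ Set.Icc x (x + l), ‖v x‖ ≤ ‖v z‖ + √l * ‖derL Φ‖ := by
    intro z hz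
    have h2 := h.norm_sub_le_of_le hz.1
    have h3 : √(z - x) ≤ √l := Real.sqrt_le_sqrt (by linarith [hz.2])
    have h4 : ‖v x‖ ≤ ‖v z‖ + ‖v z - v x‖ := by
      rw [norm_sub_rev]
      exact norm_le_insert' _ _
    nlinarith [norm_nonneg (derL Φ)]
  have hle : x ≤ x + l := by linarith
  have hv : IntervalIntegrable (fun z => ‖v z‖) volume x (x + l) := h.1.norm.intervalIntegrable _ _
  have h5 := intervalIntegral.integral_mono_on hle
    (intervalIntegrable_const (c := ‖v x‖)) (hv.add (by simp)) h1
  have h6 : ∫ z in x..(x + l), ‖v z‖ = ∫ z in x..(x + l), ‖fnL Φ z‖ := by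
    refine intervalIntegral.integral_congr_ae ?_
    filter_upwards [h.2] with z hz _
    rw [hz, fnL_apply]
  have h7 := L2.integral_norm_le (fnL Φ) hle
  rw [intervalIntegral.integral_add hv (by simp), h6] at h5
  simp only [intervalIntegral.integral_const, smul_eq_mul, add_sub_cancel_left] at h5 h7
  have hs : √l * √l = l := Real.mul_self_sqrt hl.le
  have hsp : 0 < √l := Real.sqrt_pos.mpr hl
  have h8 : √l * (√l * ‖v x‖) ≤ √l * (‖fnL Φ‖ + l * ‖derL Φ‖) := by
    rw [← mul_assoc, hs]
    nlinarith
  exact le_of_mul_le_mul_left h8 hsp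

theorem IsContinuousRep.norm_le {v : ℝ → ℂ} {Φ : H1} (h : IsContinuousRep v Φ) (x : ℝ) :
    ‖v x‖ ≤ ‖fnL Φ‖ + ‖derL Φ‖ := by
  simpa using h.sqrt_mul_norm_le x one_pos

theorem IsContinuousRep.norm_le_two_mul {v : ℝ → ℂ} {Φ : H1} (h : IsContinuousRep v Φ) (x : ℝ) :
    ‖v x‖ ≤ 2 * ‖Φ‖ := by
  have h1 : ‖(Φ : WithLp 2 (L2 × L2))‖ ^ 2 = ‖fnL Φ‖ ^ 2 + ‖derL Φ‖ ^ 2 :=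
    WithLp.prod_norm_sq_eq_of_L2 (Φ : WithLp 2 (L2 × L2))
  have h2 : ‖fnL Φ‖ ≤ ‖Φ‖ := by
    refine abs_le_of_sq_le_sq' ?_ (norm_nonneg _) |>.2
    rw [Submodule.coe_norm, h1]
    nlinarith [sq_nonneg ‖derL Φ‖]
  have h3 : ‖derL Φ‖ ≤ ‖Φ‖ := by
    refine abs_le_of_sq_le_sq' ?_ (norm_nonneg _) |>.2
    rw [Submodule.coe_norm, h1]
    nlinarith [sq_nonneg ‖fnL Φ‖]
  linarith [h.norm_le x]

/-! ### Test functions are dense in `H1` -/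

/-- A continuous compactly supported function as a square integrable function. -/
def testL2 (χ : ℝ → ℂ) (hc : Continuous χ) (hs : HasCompactSupport χ) : L2 :=
  (hc.memLp_of_hasCompactSupport hs : MemLp χ 2 volume).toLp χ

theorem coeFn_testL2 {χ : ℝ → ℂ} (hc : Continuous χ) (hs : HasCompactSupport χ) :
    testL2 χ hc hs =ᵐ[volume] χ := MemLp.coeFn_toLp _

theorem inner_testL2 {χ : ℝ → ℂ} (hc : Continuous χ) (hs : HasCompactSupport χ) (f : L2) :
    inner ℂ (testL2 χ hc hs) f = ∫ x, f x * conj (χ x) := by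
  rw [MeasureTheory.L2.inner_def]
  refine integral_congr_ae ?_
  filter_upwards [coeFn_testL2 hc hs] with x hx
  rw [hx]
  rfl

theorem contDiff_conj {θ : ℝ → ℂ} (hθ : ContDiff ℝ ∞ θ) : ContDiff ℝ ∞ fun x => conj (θ x) :=
  Complex.conjCLE.contDiff.comp hθ

theorem hasCompactSupport_conj {θ : ℝ → ℂ} (hθ : HasCompactSupport θ) :
    HasCompactSupport fun x => conj (θ x) :=
  hθ.comp_left (g := fun z : ℂ => conj z) (map_zero _)

theorem deriv_conj {θ : ℝ → ℂ} (hθ : ContDiff ℝ ∞ θ) (x : ℝ) :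
    deriv (fun x => conj (θ x)) x = conj (deriv θ x) := by
  have := (hθ.differentiable (by simp) x).hasDerivAt
  exact (Complex.conjCLE.hasFDerivAt.comp_hasDerivAt x this).deriv

/-- The bilinear pairing with a test function, as an inner product. -/
theorem integral_mul_eq_inner {χ : ℝ → ℂ} (hc : Continuous χ) (hs : HasCompactSupport χ) (f : L2) :
    ∫ x, f x * χ x = inner ℂ (testL2 (fun x => conj (χ x)) (Complex.continuous_conj.comp hc)
      (hasCompactSupport_conj hs)) f := by
  rw [inner_testL2]
  simp

/-- Integration by parts for smooth functions of compact support. -/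
theorem integral_mul_deriv_smooth {θ η : ℝ → ℂ} (hθ : ContDiff ℝ ∞ θ) (hc : HasCompactSupport θ)
    (hη : ContDiff ℝ ∞ η) :
    ∫ x, θ x * deriv η x = -∫ x, deriv θ x * η x := by
  have hd := hη.continuous_deriv (by simp : (1 : WithTop ℕ∞) ≤ ((⊤ : ℕ∞) : WithTop ℕ∞))
  have hd' := hθ.continuous_deriv (by simp : (1 : WithTop ℕ∞) ≤ ((⊤ : ℕ∞) : WithTop ℕ∞))
  exact integral_mul_deriv_eq_deriv_mul_of_integrable
    (fun x _ => (hθ.differentiable (by simp) x).hasDerivAt)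
    (fun x _ => (hη.differentiable (by simp) x).hasDerivAt)
    ((hθ.continuous.mul hd).integrable_of_hasCompactSupport hc.mul_right)
    ((hd'.mul hη.continuous).integrable_of_hasCompactSupport hc.deriv.mul_right)
    ((hθ.continuous.mul hη.continuous).integrable_of_hasCompactSupport hc.mul_right)

/-- A test function as an element of `H¹`. -/
def testH1 (θ : ℝ → ℂ) (hθ : ContDiff ℝ ∞ θ) (hc : HasCompactSupport θ) : H1 :=
  ⟨WithLp.toLp 2 (testL2 θ hθ.continuous hc,
    testL2 (deriv θ) (hθ.continuous_deriv (by simp)) hc.deriv), by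
    intro χ hχ hs
    have h1 := coeFn_testL2 hθ.continuous hc
    have h2 := coeFn_testL2 (hθ.continuous_deriv (by simp)) hc.deriv
    calc _ = ∫ x, θ x * deriv χ x := integral_congr_ae (by
            filter_upwards [h1] with x hx
            exact congrArg (· * deriv χ x) hx)
      _ = -∫ x, deriv θ x * χ x := integral_mul_deriv_smooth hθ hc hχ
      _ = _ := congrArg Neg.neg (integral_congr_ae (by
            filter_upwards [h2] with x hx
            exact congrArg (· * χ x) hx.symm))⟩

theorem fnL_testH1 {θ : ℝ → ℂ} (hθ : ContDiff ℝ ∞ θ) (hc : HasCompactSupport θ) :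
    fnL (testH1 θ hθ hc) = testL2 θ hθ.continuous hc := rfl

theorem derL_testH1 {θ : ℝ → ℂ} (hθ : ContDiff ℝ ∞ θ) (hc : HasCompactSupport θ) :
    derL (testH1 θ hθ hc) = testL2 (deriv θ) (hθ.continuous_deriv (by simp)) hc.deriv := rfl

theorem isContinuousRep_testH1 {θ : ℝ → ℂ} (hθ : ContDiff ℝ ∞ θ) (hc : HasCompactSupport θ) :
    IsContinuousRep θ (testH1 θ hθ hc) :=
  ⟨hθ.continuous, (coeFn_testL2 hθ.continuous hc).symm⟩

/-- Each test function imposes a closed condition on the pair. The resulting completeness allows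
density to be checked on the orthogonal complement. -/
theorem isClosed_H1 : IsClosed (H1 : Set (WithLp 2 (L2 × L2))) := by
  have : (H1 : Set (WithLp 2 (L2 × L2))) = ⋂ (χ : ℝ → ℂ) (_ : ContDiff ℝ ∞ χ)
      (_ : HasCompactSupport χ), {p | ∫ x, p.fst x * deriv χ x = -∫ x, p.snd x * χ x} := by
    ext p
    simp only [Set.mem_iInter]
    rfl
  rw [this]
  refine isClosed_iInter fun χ => isClosed_iInter fun hχ => isClosed_iInter fun hs => ?_
  simp only [integral_mul_eq_inner (hχ.continuous_deriv (by simp)) hs.deriv,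
    integral_mul_eq_inner hχ.continuous hs]
  exact isClosed_eq (continuous_const.inner (WithLp.fstL 2 ℂ L2 L2).continuous)
    (continuous_const.inner (WithLp.sndL 2 ℂ L2 L2).continuous).neg

instance : CompleteSpace H1 := isClosed_H1.completeSpace_coe

/-- A square integrable function which weakly satisfies `k' = σ k`, `σ` real nonzero, vanishes. -/
theorem ae_zero_of_weak_exponential {k : ℝ → ℂ} (hk : MemLp k 2 volume) {σ : ℝ}
    (hσ : σ = 1 ∨ σ = -1)
    (h : ∀ θ : ℝ → ℂ, ContDiff ℝ ∞ θ → HasCompactSupport θ →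
      ∫ x, k x * (deriv θ x + σ * θ x) = 0) : k =ᵐ[volume] 0 := by
  have hkl : LocallyIntegrable k volume := hk.locallyIntegrable (by norm_num)
  have hE : ContDiff ℝ ∞ fun x : ℝ => Complex.exp (-(σ * x)) :=
    (contDiff_const.mul Complex.ofRealCLM.contDiff).neg.cexp
  have hEd : ∀ x : ℝ, HasDerivAt (fun x : ℝ => Complex.exp (-(σ * x)))
      (Complex.exp (-(σ * x)) * -σ) x := by
    intro x
    have h1 : HasDerivAt (fun x : ℝ => (x : ℂ)) 1 x := Complex.ofRealCLM.hasDerivAt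
    have h2 := ((h1.const_mul (σ : ℂ)).neg).cexp
    simpa using h2
  obtain ⟨c, hc⟩ := ae_const_of_weak_deriv_zero (c := fun x => k x * Complex.exp (-(σ * x)))
    (by
      have := hkl.locallyIntegrableOn Set.univ
      rw [← locallyIntegrableOn_univ]
      exact this.mul_continuousOn hE.continuous.continuousOn isClosed_univ.isLocallyClosed)
    -- The integrating factor `exp (-σ x)` turns the equation into a vanishing weak derivative.
    (fun η hη hηc => by
      rw [← h (fun x => Complex.exp (-(σ * x)) * η x) (hE.mul hη) hηc.mul_left]
      congr 1
      ext x
      have h3 := ((hEd x).mul (hη.differentiable (by simp) x).hasDerivAt).deriv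
      simp only [Pi.mul_def] at h3
      rw [h3]
      ring)
  have hkc : k =ᵐ[volume] fun x => c * Complex.exp (σ * x) := by
    filter_upwards [hc] with x hx
    rw [← hx, mul_assoc, ← Complex.exp_add]
    simp
  suffices c = 0 by
    filter_upwards [hkc] with x hx
    simp [hx, this]
  by_contra hc0
  have hpos : ENNReal.ofReal ‖c‖ ≠ 0 := by simpa using hc0
  have hlt := hk.meas_ge_lt_top (by norm_num) (by norm_num)
    (ε := ‖c‖₊) (by simpa using hc0)
  -- If `c ≠ 0` then `‖k‖ ≥ ‖c‖` almost everywhere on a half-line of infinite measure, which square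
  -- integrability forbids.
  have hsub : volume {x : ℝ | 0 ≤ σ * x} ≤ volume {x | ‖c‖₊ ≤ ‖k x‖₊} := by
    refine measure_mono_ae ?_
    filter_upwards [hkc] with x hx hx0
    change ‖c‖₊ ≤ ‖k x‖₊
    rw [← NNReal.coe_le_coe, coe_nnnorm, coe_nnnorm, hx, norm_mul, Complex.norm_exp]
    have : (1 : ℝ) ≤ Real.exp ((σ : ℂ) * (x : ℂ)).re := by
      rw [Real.one_le_exp_iff]
      have : 0 ≤ σ * x := hx0
      simpa using this
    nlinarith [norm_nonneg c]
  have htop : volume {x : ℝ | 0 ≤ σ * x} = ⊤ := by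
    rcases hσ with rfl | rfl
    · have : {x : ℝ | 0 ≤ 1 * x} = Set.Ici 0 := by ext; simp
      rw [this, Real.volume_Ici]
    · have : {x : ℝ | 0 ≤ -1 * x} = Set.Iic 0 := by ext; simp
      rw [this, Real.volume_Iic]
  rw [htop] at hsub
  exact absurd hlt (not_lt.mpr (hsub.trans le_rfl))

theorem H1.ext_pair {Φ Θ : H1} (h1 : fnL Φ = fnL Θ) (h2 : derL Φ = derL Θ) : Φ = Θ :=
  Subtype.ext (WithLp.ofLp_injective 2 (Prod.ext h1 h2))

theorem H1.inner_eq (Φ Θ : H1) :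
    inner ℂ Φ Θ = inner ℂ (fnL Φ) (fnL Θ) + inner ℂ (derL Φ) (derL Θ) := rfl

/-- The test functions in `H¹`. -/
def testSet : Set H1 :=
  {Φ | ∃ (θ : ℝ → ℂ) (hθ : ContDiff ℝ ∞ θ) (hc : HasCompactSupport θ), Φ = testH1 θ hθ hc}

theorem testH1_mem {θ : ℝ → ℂ} (hθ : ContDiff ℝ ∞ θ) (hc : HasCompactSupport θ) :
    testH1 θ hθ hc ∈ testSet := ⟨θ, hθ, hc, rfl⟩

theorem inner_testH1 {θ : ℝ → ℂ} (hθ : ContDiff ℝ ∞ θ) (hc : HasCompactSupport θ) (r : H1) :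
    inner ℂ (testH1 θ hθ hc) r =
      (∫ x, fnL r x * conj (θ x)) + ∫ x, derL r x * conj (deriv θ x) := by
  rw [H1.inner_eq, fnL_testH1, derL_testH1, inner_testL2, inner_testL2]

/-- An element `r` orthogonal to all test functions solves `r'' = r` weakly. Then `k = r ± r'`
satisfies `k' = ±k`, whose only square integrable solution is zero, and `r`, `r'` are half the sum
and half the difference of these. -/
theorem dense_span_testSet : Dense (Submodule.span ℂ testSet : Set H1) := by
  rw [Submodule.dense_iff_topologicalClosure_eq_top, Submodule.topologicalClosure_eq_top_iff,
    eq_bot_iff]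
  intro r hr
  rw [Submodule.mem_orthogonal] at hr
  have h1 : ∀ θ : ℝ → ℂ, ContDiff ℝ ∞ θ → HasCompactSupport θ →
      (∫ x, fnL r x * θ x) + ∫ x, derL r x * deriv θ x = 0 := by
    intro θ hθ hc
    have := hr _ (Submodule.subset_span
      (testH1_mem (contDiff_conj hθ) (hasCompactSupport_conj hc)))
    rw [inner_testH1] at this
    simpa only [deriv_conj hθ, Complex.conj_conj] using this
  have hi : ∀ (f : L2) (θ : ℝ → ℂ), ContDiff ℝ ∞ θ → HasCompactSupport θ →
      Integrable (fun x => f x * θ x) := fun f θ hθ hc => integrable_L2_mul f hθ.continuous hc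
  have hi' : ∀ (f : L2) (θ : ℝ → ℂ), ContDiff ℝ ∞ θ → HasCompactSupport θ →
      Integrable (fun x => f x * deriv θ x) := fun f θ hθ hc =>
    integrable_L2_mul f (hθ.continuous_deriv (by simp)) hc.deriv
  have key : ∀ σ : ℝ, σ = 1 ∨ σ = -1 →
      (fun x => fnL r x + σ * derL r x) =ᵐ[volume] 0 := by
    intro σ hσ
    have hm : MemLp (fun x => fnL r x + σ * derL r x) 2 volume :=
      MemLp.add (Lp.memLp (fnL r)) (MemLp.const_mul (Lp.memLp (derL r)) (σ : ℂ))
    refine ae_zero_of_weak_exponential hm hσ fun θ hθ hc => ?_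
    have e1 := h1 θ hθ hc
    have e2 := weak_derL r hθ hc
    have hσ2 : (σ : ℂ) * σ = 1 := by rcases hσ with rfl | rfl <;> simp
    calc _ = ∫ x, ((fnL r x * deriv θ x + σ * (fnL r x * θ x)) +
          (σ * (derL r x * deriv θ x) + derL r x * θ x)) := by
          congr 1
          ext x
          linear_combination (derL r x * θ x) * hσ2
      _ = ((∫ x, fnL r x * deriv θ x) + σ * ∫ x, fnL r x * θ x) +
          (σ * (∫ x, derL r x * deriv θ x) + ∫ x, derL r x * θ x) := by
          rw [integral_add, integral_add, integral_add, integral_const_mul, integral_const_mul]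
          · exact (hi' _ θ hθ hc).const_mul _
          · exact hi _ θ hθ hc
          · exact hi' _ θ hθ hc
          · exact (hi _ θ hθ hc).const_mul _
          · exact (hi' _ θ hθ hc).add ((hi _ θ hθ hc).const_mul _)
          · exact ((hi' _ θ hθ hc).const_mul _).add (hi _ θ hθ hc)
      _ = 0 := by
          rw [e2]
          linear_combination (σ : ℂ) * e1
  have k1 := key 1 (Or.inl rfl)
  have k2 := key (-1) (Or.inr rfl)
  refine H1.ext_pair ?_ ?_
  · rw [map_zero]
    refine (Lp.eq_zero_iff_ae_eq_zero).mpr ?_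
    filter_upwards [k1, k2] with x h1 h2
    simp only [Pi.zero_apply] at h1 h2 ⊢
    push_cast at h1 h2
    linear_combination (1 / 2 : ℂ) * h1 + (1 / 2 : ℂ) * h2
  · rw [map_zero]
    refine (Lp.eq_zero_iff_ae_eq_zero).mpr ?_
    filter_upwards [k1, k2] with x h1 h2
    simp only [Pi.zero_apply] at h1 h2 ⊢
    push_cast at h1 h2
    linear_combination (1 / 2 : ℂ) * h1 - (1 / 2 : ℂ) * h2

/-! ### Point evaluation on `H1` -/

theorem exists_isContinuousRep (Φ : H1) : ∃ v, IsContinuousRep v Φ := by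
  obtain ⟨k, hk⟩ := ae_eq_primitive_of_weak_deriv (L2.locallyIntegrable (fnL Φ))
    (L2.locallyIntegrable (derL Φ)) fun θ hθ hc => weak_derL Φ hθ hc
  exact ⟨_, continuous_const.add (locallyIntegrable_primitive (L2.locallyIntegrable _)), hk.symm⟩

theorem IsContinuousRep.unique {v w : ℝ → ℂ} {Φ : H1} (h : IsContinuousRep v Φ)
    (h' : IsContinuousRep w Φ) : v = w :=
  (h.1.ae_eq_iff_eq volume h'.1).mp (h.2.trans h'.2.symm)

theorem IsContinuousRep.const_smul {v : ℝ → ℂ} {Φ : H1} (h : IsContinuousRep v Φ) (c : ℂ) :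
    IsContinuousRep (fun x => c * v x) (c • Φ) := by
  refine ⟨continuous_const.mul h.1, ?_⟩
  filter_upwards [h.2, Lp.coeFn_smul c (fnL Φ)] with x h1 h2
  rw [h1]
  exact h2.symm

/-- Evaluation at a point, as a continuous functional on `H¹`. -/
def evalL (x : ℝ) : H1 →L[ℂ] ℂ :=
  LinearMap.mkContinuous
    { toFun := fun Φ => (exists_isContinuousRep Φ).choose x
      map_add' := fun Φ Θ => congrFun ((exists_isContinuousRep (Φ + Θ)).choose_spec.unique
        ((exists_isContinuousRep Φ).choose_spec.add (exists_isContinuousRep Θ).choose_spec)) x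
      map_smul' := fun c Φ => congrFun ((exists_isContinuousRep (c • Φ)).choose_spec.unique
        ((exists_isContinuousRep Φ).choose_spec.const_smul c)) x } 2
    fun Φ => (exists_isContinuousRep Φ).choose_spec.norm_le_two_mul x

theorem IsContinuousRep.evalL_eq {v : ℝ → ℂ} {Φ : H1} (h : IsContinuousRep v Φ) (x : ℝ) :
    evalL x Φ = v x :=
  congrFun ((exists_isContinuousRep Φ).choose_spec.unique h) x

/-! ### From the distributional equation to a weak form integrated in time -/

theorem deriv_mul_const_right {η : ℝ → ℂ} (hη : ContDiff ℝ ∞ η) (c : ℂ) (t : ℝ) :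
    deriv (fun s => c * η s) t = c * deriv η t :=
  ((hη.differentiable (by simp) t).hasDerivAt.const_mul c).deriv

theorem iteratedDeriv_two_mul_const {θ : ℝ → ℂ} (hθ : ContDiff ℝ ∞ θ) (c : ℂ) (x : ℝ) :
    iteratedDeriv 2 (fun y => θ y * c) x = deriv (deriv θ) x * c := by
  have hd : ∀ y, deriv (fun y => θ y * c) y = deriv θ y * c := fun y =>
    ((hθ.differentiable (by simp) y).hasDerivAt.mul_const c).deriv
  have hθ' : ContDiff ℝ ∞ (deriv θ) := (contDiff_infty_iff_deriv.mp hθ).2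
  rw [iteratedDeriv_succ, iteratedDeriv_one, funext hd]
  exact ((hθ'.differentiable (by simp) x).hasDerivAt.mul_const c).deriv

/-- Take the test function `θ(x) η(t)`. One of the two space derivatives is moved onto the solution,
so that only its derivative in `L2` remains. -/
theorem SolvesNLS.separated {F : ℂ → ℂ} {ψ : ℝ × ℝ → ℂ} (hψ : SolvesNLS F ψ) {Ψ : ℝ → H1}
    (hrep : ∀ t, IsContinuousRep (fun x => ψ (x, t)) (Ψ t))
    {θ η : ℝ → ℂ} (hθ : ContDiff ℝ ∞ θ) (hθc : HasCompactSupport θ)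
    (hη : ContDiff ℝ ∞ η) (hηc : HasCompactSupport η) :
    -(Complex.I * ∫ t, (∫ x, fnL (Ψ t) x * θ x) * deriv η t) =
      (∫ t, (∫ x, derL (Ψ t) x * deriv θ x) * η t) - ∫ t, F (ψ (0, t)) * (θ 0 * η t) := by
  have hθ' : ContDiff ℝ ∞ (deriv θ) := (contDiff_infty_iff_deriv.mp hθ).2
  have h := hψ (fun p => θ p.1 * η p.2) ((hθ.comp contDiff_fst).mul (hη.comp contDiff_snd)) (by
    refine HasCompactSupport.of_support_subset_isCompact (hθc.isCompact.prod hηc.isCompact) ?_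
    intro p hp
    exact ⟨subset_tsupport _ (left_ne_zero_of_mul hp), subset_tsupport _ (right_ne_zero_of_mul hp)⟩)
  simp only [deriv_mul_const_right hη, iteratedDeriv_two_mul_const hθ] at h
  have e1 : ∀ t, ∫ x, ψ (x, t) * -(Complex.I * (θ x * deriv η t)) =
      -Complex.I * ((∫ x, fnL (Ψ t) x * θ x) * deriv η t) := by
    intro t
    rw [← integral_mul_const, ← integral_const_mul]
    refine integral_congr_ae ?_
    filter_upwards [(hrep t).2] with x hx
    rw [hx, fnL_apply]
    ring
  have e2 : ∀ t, ∫ x, ψ (x, t) * -(deriv (deriv θ) x * η t) =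
      (∫ x, derL (Ψ t) x * deriv θ x) * η t := by
    intro t
    have h2 := (hrep t).weak hθ' hθc.deriv
    rw [← neg_eq_iff_eq_neg] at h2
    rw [← h2, ← integral_neg, ← integral_mul_const]
    congr 1
    ext x
    ring
  simp only [e1, e2] at h
  rw [integral_const_mul] at h
  rw [← h]
  ring

/-- For fixed `θ`, `SolvesNLS.separated` says that the pairing with `θ` has a continuous weak
derivative in time; the du Bois-Reymond lemma in `t` integrates it. -/
theorem SolvesNLS.weak_test {F : ℂ → ℂ} (hF : Continuous F) {ψ : ℝ × ℝ → ℂ} (hψ : SolvesNLS F ψ)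
    {Ψ : ℝ → H1} (hΨ : Continuous Ψ) (hrep : ∀ t, IsContinuousRep (fun x => ψ (x, t)) (Ψ t))
    {θ : ℝ → ℂ} (hθ : ContDiff ℝ ∞ θ) (hθc : HasCompactSupport θ) (a b : ℝ) :
    (∫ x, fnL (Ψ b) x * θ x) - (∫ x, fnL (Ψ a) x * θ x) =
      ∫ t in a..b, (-Complex.I * (∫ x, derL (Ψ t) x * deriv θ x) +
        Complex.I * (F (ψ (0, t)) * θ 0)) := by
  have hy : Continuous fun t => ψ (0, t) := by
    have : (fun t => ψ (0, t)) = fun t => evalL 0 (Ψ t) :=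
      funext fun t => ((hrep t).evalL_eq 0).symm
    rw [this]
    exact (evalL 0).continuous.comp hΨ
  have hp : Continuous fun t => ∫ x, derL (Ψ t) x * deriv θ x := by
    simp only [integral_mul_eq_inner (hθ.continuous_deriv (by simp)) hθc.deriv]
    exact continuous_const.inner (derL.continuous.comp hΨ)
  have hq : Continuous fun t => ∫ x, fnL (Ψ t) x * θ x := by
    simp only [integral_mul_eq_inner hθ.continuous hθc]
    exact continuous_const.inner (fnL.continuous.comp hΨ)
  have hf : Continuous fun t => F (ψ (0, t)) * θ 0 := (hF.comp hy).mul continuous_const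
  have hb : Continuous fun t => -Complex.I * (∫ x, derL (Ψ t) x * deriv θ x) +
      Complex.I * (F (ψ (0, t)) * θ 0) := (continuous_const.mul hp).add (continuous_const.mul hf)
  refine sub_eq_integral_of_weak_deriv hq hb.locallyIntegrable (fun η hη hηc => ?_) a b
  have h := hψ.separated hrep hθ hθc hη hηc
  have i1 : Integrable fun t => (∫ x, derL (Ψ t) x * deriv θ x) * η t :=
    (hp.mul hη.continuous).integrable_of_hasCompactSupport hηc.mul_left
  have i2 : Integrable fun t => F (ψ (0, t)) * (θ 0 * η t) := by
    simp only [← mul_assoc]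
    exact (hf.mul hη.continuous).integrable_of_hasCompactSupport hηc.mul_left
  rw [← integral_sub i1 i2] at h
  have h2 : ∫ t, (-Complex.I * (∫ x, derL (Ψ t) x * deriv θ x) +
        Complex.I * (F (ψ (0, t)) * θ 0)) * η t = -Complex.I *
      ∫ t, ((∫ x, derL (Ψ t) x * deriv θ x) * η t - F (ψ (0, t)) * (θ 0 * η t)) := by
    rw [← integral_const_mul]
    congr 1
    ext t
    ring
  rw [h2, ← h]
  linear_combination ((∫ t, (∫ x, fnL (Ψ t) x * θ x) * deriv η t)) * Complex.I_mul_I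

/-- The weak form of the equation, integrated in time, against all of `H¹`. -/
theorem SolvesNLS.weak_H1 {F : ℂ → ℂ} (hF : Continuous F) {ψ : ℝ × ℝ → ℂ} (hψ : SolvesNLS F ψ)
    {Ψ : ℝ → H1} (hΨ : Continuous Ψ) (hrep : ∀ t, IsContinuousRep (fun x => ψ (x, t)) (Ψ t))
    (Φ : H1) (a b : ℝ) :
    inner ℂ (fnL (Ψ b) - fnL (Ψ a)) (fnL Φ) =
      Complex.I * inner ℂ (∫ t in a..b, derL (Ψ t)) (derL Φ) -
        Complex.I * conj (∫ t in a..b, F (ψ (0, t))) * evalL 0 Φ := by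
  have hy : Continuous fun t => ψ (0, t) := by
    have : (fun t => ψ (0, t)) = fun t => evalL 0 (Ψ t) :=
      funext fun t => ((hrep t).evalL_eq 0).symm
    rw [this]
    exact (evalL 0).continuous.comp hΨ
  have hp : Continuous fun t => derL (Ψ t) := derL.continuous.comp hΨ
  let A : H1 →L[ℂ] ℂ := (innerSL ℂ (fnL (Ψ b) - fnL (Ψ a))).comp fnL
  let B : H1 →L[ℂ] ℂ := Complex.I • (innerSL ℂ (∫ t in a..b, derL (Ψ t))).comp derL -
    (Complex.I * conj (∫ t in a..b, F (ψ (0, t)))) • evalL 0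
  suffices A = B from congrArg (fun T : H1 →L[ℂ] ℂ => T Φ) this
  -- The increments occupy the antilinear slot, so both sides are continuous and linear in `Φ`.
  -- Agreement on test functions therefore suffices.
  refine ContinuousLinearMap.ext_on dense_span_testSet ?_
  rintro _ ⟨θ, hθ, hc, rfl⟩
  change inner ℂ (fnL (Ψ b) - fnL (Ψ a)) (fnL (testH1 θ hθ hc)) =
      Complex.I * inner ℂ (∫ t in a..b, derL (Ψ t)) (derL (testH1 θ hθ hc)) -
        Complex.I * conj (∫ t in a..b, F (ψ (0, t))) * evalL 0 (testH1 θ hθ hc)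
  rw [(isContinuousRep_testH1 hθ hc).evalL_eq, fnL_testH1, derL_testH1, ← inner_conj_symm,
    ← inner_conj_symm (∫ t in a..b, derL (Ψ t)), inner_sub_right]
  have h := hψ.weak_test hF hΨ hrep (contDiff_conj hθ) (hasCompactSupport_conj hc) a b
  have hd := hθ.continuous_deriv (n := ∞) (by simp)
  simp only [deriv_conj hθ] at h
  simp only [← inner_testL2 hθ.continuous hc, ← inner_testL2 hd hc.deriv] at h
  have hint : inner ℂ (testL2 (deriv θ) hd hc.deriv) (∫ t in a..b, derL (Ψ t)) =
      ∫ t in a..b, inner ℂ (testL2 (deriv θ) hd hc.deriv) (derL (Ψ t)) :=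
    ((innerSL ℂ (testL2 (deriv θ) hd hc.deriv)).intervalIntegral_comp_comm
      (hp.intervalIntegrable _ _)).symm
  rw [h, hint, intervalIntegral.integral_add, intervalIntegral.integral_const_mul,
    intervalIntegral.integral_const_mul, intervalIntegral.integral_mul_const]
  · simp only [map_add, map_mul, map_neg, Complex.conj_I, Complex.conj_conj]
    ring
  · exact (continuous_const.mul (continuous_const.inner hp)).intervalIntegrable _ _
  · exact (continuous_const.mul ((hF.comp hy).mul continuous_const)).intervalIntegrable _ _

/-! ### Weak solutions: charge and increments -/

/-- A continuous path in `H¹` solving `i Ψ_t = -Ψ_xx - δ f` weakly. -/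
structure WeakSolution (Ψ : ℝ → H1) (f : ℝ → ℂ) : Prop where
  continuous_path : Continuous Ψ
  continuous_source : Continuous f
  weak : ∀ (Φ : H1) (a b : ℝ), inner ℂ (fnL (Ψ b) - fnL (Ψ a)) (fnL Φ) =
    Complex.I * inner ℂ (∫ t in a..b, derL (Ψ t)) (derL Φ) -
      Complex.I * inner ℂ (∫ t in a..b, f t) (evalL 0 Φ)

theorem inner_self_eq_ofReal {E : Type*} [NormedAddCommGroup E] [InnerProductSpace ℂ E] (x : E) :
    inner ℂ x x = ((‖x‖ ^ 2 : ℝ) : ℂ) := by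
  rw [inner_self_eq_norm_sq_to_K, Complex.ofReal_pow]
  rfl

/-- Derivative of an inner product one of whose factors vanishes at the point. -/
theorem hasDerivAt_inner_of_eq_zero {E : Type*} [NormedAddCommGroup E] [InnerProductSpace ℂ E]
    {P c : ℝ → E} {P' : E} {t : ℝ} (hP : HasDerivAt P P' t) (h0 : P t = 0)
    (hc : ContinuousAt c t) : HasDerivAt (fun s => inner ℂ (P s) (c s)) (inner ℂ P' (c t)) t := by
  rw [hasDerivAt_iff_tendsto_slope] at hP ⊢
  have h := hP.inner (𝕜 := ℂ) (hc.tendsto.mono_left nhdsWithin_le_nhds)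
  refine h.congr fun s => ?_
  rw [slope_def_module, slope_def_module, h0, sub_zero, inner_zero_left, sub_zero,
    ← Complex.coe_smul, inner_smul_left, Complex.conj_ofReal, Complex.real_smul]

theorem hasDerivAt_integral_zero_self {E : Type*} [NormedAddCommGroup E] [NormedSpace ℝ E]
    [CompleteSpace E] {p : ℝ → E} (hp : Continuous p) (a t : ℝ) :
    HasDerivAt (fun s => ∫ r in a..s, p r) (p t) t :=
  (hp.integral_hasStrictDerivAt a t).hasDerivAt

/-- The derivative of the Steklov integral. -/
theorem hasDerivAt_integral_window {E : Type*} [NormedAddCommGroup E] [NormedSpace ℝ E]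
    [CompleteSpace E] {p : ℝ → E} (hp : Continuous p) (h t : ℝ) :
    HasDerivAt (fun s => ∫ r in s..(s + h), p r) (p (t + h) - p t) t := by
  have h1 : (fun s => ∫ r in s..(s + h), p r) =
      fun s => (∫ r in (0 : ℝ)..(s + h), p r) - ∫ r in (0 : ℝ)..s, p r := by
    ext s
    exact (intervalIntegral.integral_interval_sub_left (hp.intervalIntegrable _ _)
      (hp.intervalIntegrable _ _)).symm
  rw [h1]
  exact ((hasDerivAt_integral_zero_self hp 0 (t + h)).comp_add_const t h).sub
    (hasDerivAt_integral_zero_self hp 0 t)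

namespace WeakSolution

variable {Ψ : ℝ → H1} {f : ℝ → ℂ}

theorem continuous_der (h : WeakSolution Ψ f) : Continuous fun t => derL (Ψ t) :=
  derL.continuous.comp h.continuous_path

theorem continuous_trace (h : WeakSolution Ψ f) : Continuous fun t => evalL 0 (Ψ t) :=
  (evalL 0).continuous.comp h.continuous_path

/-- Conservation of charge. -/
theorem norm_fn_eq (h : WeakSolution Ψ f) (hf : ∀ t, (f t * conj (evalL 0 (Ψ t))).im = 0)
    (a b : ℝ) : ‖fnL (Ψ b)‖ = ‖fnL (Ψ a)‖ := by
  have key : ∀ t, HasDerivAt (fun s => ‖fnL (Ψ s)‖ ^ 2) 0 t := by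
    intro t
    -- Since `‖p‖² - ‖q‖² = Re ⟨p - q, p + q⟩`, the weak form applies with `Φ = Ψ s + Ψ t`. The time
    -- integrals vanish at `s = t`, so mere continuity of the other factors is enough to
    -- differentiate there. The kinetic term is then purely imaginary, and the source term has no
    -- real part by `hf`.
    have e : (fun s => ‖fnL (Ψ s)‖ ^ 2) = fun s => ‖fnL (Ψ t)‖ ^ 2 +
        (Complex.I * inner ℂ (∫ r in t..s, derL (Ψ r)) (derL (Ψ s + Ψ t)) -
          Complex.I * inner ℂ (∫ r in t..s, f r) (evalL 0 (Ψ s + Ψ t))).re := by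
      ext s
      rw [← h.weak, map_add, inner_add_right, inner_sub_left, inner_sub_left,
        inner_self_eq_ofReal, inner_self_eq_ofReal, ← inner_conj_symm (fnL (Ψ s))]
      simp only [Complex.add_re, Complex.sub_re, Complex.conj_re, Complex.ofReal_re]
      ring
    rw [e]
    have c1 : ContinuousAt (fun s => derL (Ψ s + Ψ t)) t :=
      (derL.continuous.comp (h.continuous_path.add continuous_const)).continuousAt
    have c2 : ContinuousAt (fun s => evalL 0 (Ψ s + Ψ t)) t :=
      ((evalL 0).continuous.comp (h.continuous_path.add continuous_const)).continuousAt
    have d1 := hasDerivAt_inner_of_eq_zero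
      (hasDerivAt_integral_zero_self h.continuous_der t t) (by simp) c1
    have d2 := hasDerivAt_inner_of_eq_zero
      (hasDerivAt_integral_zero_self h.continuous_source t t) (by simp) c2
    have d := ((d1.const_mul Complex.I).sub (d2.const_mul Complex.I))
    have d' := (Complex.reCLM.hasFDerivAt.comp_hasDerivAt t d).const_add (‖fnL (Ψ t)‖ ^ 2)
    refine d'.congr_deriv ?_
    have h1 := hf t
    rw [Complex.reCLM_apply, map_add, map_add, inner_add_right, inner_add_right,
      inner_self_eq_ofReal]
    simp only [RCLike.inner_apply, Complex.mul_im, Complex.conj_im, Complex.conj_re] at h1 ⊢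
    simp only [Complex.sub_re, Complex.mul_re, Complex.I_re, Complex.I_im, Complex.add_re,
      Complex.add_im, Complex.mul_im, Complex.conj_im, Complex.conj_re, Complex.ofReal_im]
    linarith
  have hc := is_const_of_deriv_eq_zero (fun t => (key t).differentiableAt) (fun t => (key t).deriv)
    b a
  exact (sq_eq_sq₀ (norm_nonneg _) (norm_nonneg _)).mp hc

/-- The identity obtained by testing the equation with an increment of the solution. -/
theorem norm_sq_sub (h : WeakSolution Ψ f) (a b : ℝ) :
    ((‖fnL (Ψ b) - fnL (Ψ a)‖ ^ 2 : ℝ) : ℂ) =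
      Complex.I * inner ℂ (∫ t in a..b, derL (Ψ t)) (derL (Ψ b) - derL (Ψ a)) -
      Complex.I * inner ℂ (∫ t in a..b, f t) (evalL 0 (Ψ b) - evalL 0 (Ψ a)) := by
  have := h.weak (Ψ b - Ψ a) a b
  rw [map_sub, map_sub, map_sub, inner_self_eq_ofReal] at this
  exact this

/-- The squared norm in `norm_sq_sub` is real, so the imaginary parts on the right cancel. This
replaces testing with `ψ_t` in the energy balance. -/
theorem re_inner_increment (h : WeakSolution Ψ f) (a b : ℝ) :
    (inner ℂ (∫ t in a..b, derL (Ψ t)) (derL (Ψ b) - derL (Ψ a))).re =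
      (inner ℂ (∫ t in a..b, f t) (evalL 0 (Ψ b) - evalL 0 (Ψ a))).re := by
  have := congrArg Complex.im (h.norm_sq_sub a b)
  rw [Complex.ofReal_im, Complex.sub_im, Complex.I_mul_im, Complex.I_mul_im] at this
  linarith

/-- Each product has one factor that is linear in `b - a` when the path is bounded, and one that
tends to zero by continuity in `H1`. Hence the square is `o(b - a)` locally uniformly. -/
theorem norm_sq_sub_le (h : WeakSolution Ψ f) (a b : ℝ) :
    ‖fnL (Ψ b) - fnL (Ψ a)‖ ^ 2 ≤
      ‖∫ t in a..b, derL (Ψ t)‖ * ‖derL (Ψ b) - derL (Ψ a)‖ +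
      ‖∫ t in a..b, f t‖ * ‖evalL 0 (Ψ b) - evalL 0 (Ψ a)‖ := by
  have h1 := congrArg norm (h.norm_sq_sub a b)
  rw [Complex.norm_real, Real.norm_of_nonneg (by positivity)] at h1
  rw [h1]
  refine (norm_sub_le _ _).trans (add_le_add ?_ ?_)
  · rw [norm_mul, Complex.norm_I, one_mul]
    exact norm_inner_le_norm _ _
  · rw [norm_mul, Complex.norm_I, one_mul]
    exact norm_inner_le_norm _ _

end WeakSolution

/-! ### Primitives, reflection and weights on the unit interval -/

/-- The function `u` is a primitive of `u'` on the interval with endpoints `a` and `b`. -/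
structure IsPrimitiveOn (u u' : ℝ → ℂ) (a b : ℝ) : Prop where
  integrable : IntervalIntegrable u' volume a b
  eq : ∀ x ∈ Set.uIcc a b, u x = u a + ∫ t in a..x, u' t

namespace IsPrimitiveOn

variable {u v u' v' : ℝ → ℂ} {a b : ℝ}

theorem continuousOn (hu : IsPrimitiveOn u u' a b) : ContinuousOn u (Set.uIcc a b) :=
  (continuousOn_const.add
    (absolutelyContinuousOnInterval_primitive hu.integrable).continuousOn).congr hu.eq

theorem mul (hu : IsPrimitiveOn u u' a b) (hv : IsPrimitiveOn v v' a b) :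
    IsPrimitiveOn (fun x => u x * v x) (fun x => u' x * v x + u x * v' x) a b := by
  refine ⟨(hu.integrable.mul_continuousOn hv.continuousOn).add
    (hv.integrable.continuousOn_mul hu.continuousOn), fun x hx => ?_⟩
  have hs : Set.uIcc a x ⊆ Set.uIcc a b := Set.uIcc_subset_uIcc_left hx
  rw [integral_product_rule (hu.integrable.mono_set hs) (hv.integrable.mono_set hs)
    (fun y hy => hu.eq y (hs hy)) (fun y hy => hv.eq y (hs hy))]
  ring

theorem conjugate (hu : IsPrimitiveOn u u' a b) :
    IsPrimitiveOn (fun x => conj (u x)) (fun x => conj (u' x)) a b := by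
  refine ⟨⟨(Complex.conjCLE.toContinuousLinearMap.integrable_comp hu.integrable.1),
    (Complex.conjCLE.toContinuousLinearMap.integrable_comp hu.integrable.2)⟩, fun x hx => ?_⟩
  have hs : Set.uIcc a x ⊆ Set.uIcc a b := Set.uIcc_subset_uIcc_left hx
  have h := Complex.conjCLE.toContinuousLinearMap.intervalIntegral_comp_comm
    (hu.integrable.mono_set hs)
  rw [hu.eq x hx, map_add]
  exact congrArg _ h.symm

theorem of_hasDerivAt (hu : ∀ x, HasDerivAt u (u' x) x) (hc : Continuous u') (a b : ℝ) :
    IsPrimitiveOn u u' a b := by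
  refine ⟨hc.intervalIntegrable _ _, fun x _ => ?_⟩
  rw [intervalIntegral.integral_eq_sub_of_hasDerivAt (fun y _ => hu y) (hc.intervalIntegrable _ _)]
  ring

theorem integral_eq (hu : IsPrimitiveOn u u' a b) : ∫ x in a..b, u' x = u b - u a := by
  rw [hu.eq b (by simp)]
  ring

end IsPrimitiveOn

theorem isPrimitiveOn_one_sub_pow (n : ℕ) (a b : ℝ) :
    IsPrimitiveOn (fun x => ((1 - x : ℝ) : ℂ) ^ n) (fun x => -(n * ((1 - x : ℝ) : ℂ) ^ (n - 1)))
      a b := by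
  refine IsPrimitiveOn.of_hasDerivAt (fun x => ?_) (by fun_prop) a b
  have h1 : HasDerivAt (fun x : ℝ => ((1 - x : ℝ) : ℂ)) ((-1 : ℝ) : ℂ) x :=
    ((hasDerivAt_id x).const_sub 1).ofReal_comp
  have h2 := h1.pow n
  refine h2.congr_deriv ?_
  push_cast
  ring

/-- Reflection in the origin. -/
def reflL : L2 →L[ℂ] L2 :=
  (Lp.compMeasurePreservingₗᵢ ℂ (Neg.neg : ℝ → ℝ)
    (Measure.measurePreserving_neg volume)).toContinuousLinearMap

theorem coeFn_reflL (f : L2) : reflL f =ᵐ[volume] fun x => f (-x) :=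
  Lp.coeFn_compMeasurePreserving f (Measure.measurePreserving_neg volume)

theorem norm_reflL (f : L2) : ‖reflL f‖ = ‖f‖ :=
  Lp.norm_compMeasurePreserving f (Measure.measurePreserving_neg volume)

theorem norm_weight_le (n : ℕ) (x : ℝ) :
    ‖(Set.Ioc (0 : ℝ) 1).indicator (fun x => ((1 - x : ℝ) : ℂ) ^ n) x‖ ≤ 1 := by
  by_cases hx : x ∈ Set.Ioc (0 : ℝ) 1
  · rw [Set.indicator_of_mem hx, norm_pow, Complex.norm_real, Real.norm_eq_abs]
    refine pow_le_one₀ (abs_nonneg _) (abs_le.mpr ⟨?_, ?_⟩) <;> linarith [hx.1, hx.2]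
  · rw [Set.indicator_of_notMem hx, norm_zero]
    exact zero_le_one

theorem memLp_weight_mul (n : ℕ) (f : L2) :
    MemLp (fun x => (Set.Ioc (0 : ℝ) 1).indicator (fun x => ((1 - x : ℝ) : ℂ) ^ n) x * f x) 2
      volume := by
  have hm : AEStronglyMeasurable
      ((Set.Ioc (0 : ℝ) 1).indicator fun x => ((1 - x : ℝ) : ℂ) ^ n) volume :=
    ((by fun_prop : Continuous fun x : ℝ => ((1 - x : ℝ) : ℂ) ^ n).aestronglyMeasurable).indicator
      measurableSet_Ioc
  refine (Lp.memLp f).of_le (hm.mul (Lp.memLp f).1) (Filter.Eventually.of_forall fun x => ?_)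
  rw [norm_mul]
  exact mul_le_of_le_one_left (norm_nonneg _) (norm_weight_le n x)

/-- Multiplication by `(1 - x) ^ n` on `(0, 1]` and by zero elsewhere. -/
def weightL (n : ℕ) : L2 →L[ℂ] L2 :=
  LinearMap.mkContinuous
    { toFun := fun f => (memLp_weight_mul n f).toLp _
      map_add' := fun f g => by
        rw [← MemLp.toLp_add]
        refine MemLp.toLp_congr _ _ ?_
        filter_upwards [Lp.coeFn_add f g] with x hx
        rw [hx, Pi.add_apply, Pi.add_apply, mul_add]
      map_smul' := fun c f => by
        rw [RingHom.id_apply, ← MemLp.toLp_const_smul]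
        refine MemLp.toLp_congr _ _ ?_
        filter_upwards [Lp.coeFn_smul c f] with x hx
        rw [hx, Pi.smul_apply, Pi.smul_apply, smul_eq_mul, smul_eq_mul, mul_left_comm] } 1
    fun f => by
      refine Lp.norm_le_mul_norm_of_ae_le_mul ?_
      filter_upwards [(memLp_weight_mul n f).coeFn_toLp] with x hx
      change ‖((memLp_weight_mul n f).toLp _) x‖ ≤ _
      rw [hx, norm_mul]
      exact mul_le_mul_of_nonneg_right (norm_weight_le n x) (norm_nonneg _)

theorem coeFn_weightL (n : ℕ) (f : L2) : weightL n f =ᵐ[volume]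
    fun x => (Set.Ioc (0 : ℝ) 1).indicator (fun x => ((1 - x : ℝ) : ℂ) ^ n) x * f x :=
  (memLp_weight_mul n f).coeFn_toLp

theorem norm_weightL_le (n : ℕ) (f : L2) : ‖weightL n f‖ ≤ ‖f‖ := by
  simpa using (weightL n).le_of_opNorm_le
    (LinearMap.mkContinuous_norm_le _ zero_le_one _ : ‖weightL n‖ ≤ 1) f

theorem inner_weightL (n : ℕ) (f g : L2) :
    inner ℂ f (weightL n g) = ∫ x in (0 : ℝ)..1, ((1 - x : ℝ) : ℂ) ^ n * (g x * conj (f x)) := by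
  rw [MeasureTheory.L2.inner_def, intervalIntegral.integral_of_le zero_le_one,
    ← integral_indicator measurableSet_Ioc]
  refine integral_congr_ae ?_
  filter_upwards [coeFn_weightL n g] with x hx
  rw [hx, RCLike.inner_apply]
  by_cases h : x ∈ Set.Ioc (0 : ℝ) 1
  · simp only [Set.indicator_of_mem h]
    ring
  · simp only [Set.indicator_of_notMem h, zero_mul]

theorem inner_weightL_left (n : ℕ) (f g : L2) :
    inner ℂ (weightL n f) g = inner ℂ f (weightL n g) := by
  rw [inner_weightL, ← inner_conj_symm, inner_weightL,
    ← Complex.conjCLE_apply, ← ContinuousLinearEquiv.coe_coe]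
  rw [← Complex.conjCLE.toContinuousLinearMap.intervalIntegral_comp_comm]
  · refine intervalIntegral.integral_congr fun x _ => ?_
    simp only [ContinuousLinearEquiv.coe_coe, Complex.conjCLE_apply, map_mul, map_pow,
      Complex.conj_ofReal, Complex.conj_conj]
    ring
  · have h : Integrable fun x => f x * conj (g x) := by
      have := L2.integrable_inner (𝕜 := ℂ) g f
      simpa only [RCLike.inner_apply] using this
    exact h.intervalIntegrable.continuousOn_mul (by fun_prop)

/-- The indicator of `(0, 1]` as an element of `L²`. -/
def unitIndicator : L2 :=
  indicatorConstLp 2 (measurableSet_Ioc (a := (0 : ℝ)) (b := 1)) (by simp) (1 : ℂ)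

theorem norm_unitIndicator : ‖unitIndicator‖ = 1 := by
  rw [unitIndicator, norm_indicatorConstLp (by norm_num) (by norm_num)]
  simp

theorem coeFn_unitIndicator : unitIndicator =ᵐ[volume] (Set.Ioc (0 : ℝ) 1).indicator fun _ => 1 :=
  indicatorConstLp_coeFn

/-! ### Boundary chains and their integral identities -/

/-- On the unit interval, `V` is the primitive of `e` vanishing at the origin and `e` is the
primitive of `o` with value `c` at the origin. -/
def IsBoundaryChain (e o V : L2) (c : ℂ) : Prop :=
  ∃ e₀ V₀ : ℝ → ℂ, IsPrimitiveOn e₀ o 0 1 ∧ IsPrimitiveOn V₀ e₀ 0 1 ∧ e₀ 0 = c ∧ V₀ 0 = 0 ∧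
    (∀ᵐ x, x ∈ Set.uIoc (0 : ℝ) 1 → e x = e₀ x) ∧ ∀ᵐ x, x ∈ Set.uIoc (0 : ℝ) 1 → V x = V₀ x

namespace IsBoundaryChain

/-- Integrate the derivative of `(1 - x)² conj(V₂) V₁`: the primitives vanish at 0 and the weight at
1. The identity later trades a time increment of `e` for one of `V`. -/
theorem cross_identity {e₁ o₁ V₁ e₂ o₂ V₂ : L2} {c₁ c₂ : ℂ} (h₁ : IsBoundaryChain e₁ o₁ V₁ c₁)
    (h₂ : IsBoundaryChain e₂ o₂ V₂ c₂) :
    inner ℂ e₂ (weightL 2 V₁) + inner ℂ V₂ (weightL 2 e₁) = 2 * inner ℂ V₂ (weightL 1 V₁) := by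
  obtain ⟨f₁, W₁, hf₁, hW₁, -, h01, he₁, hV₁⟩ := h₁
  obtain ⟨f₂, W₂, hf₂, hW₂, -, h02, he₂, hV₂⟩ := h₂
  have key := ((isPrimitiveOn_one_sub_pow 2 0 1).mul (hW₂.conjugate.mul hW₁)).integral_eq
  have cf₁ := hf₁.continuousOn
  have cf₂ := hf₂.conjugate.continuousOn
  have cW₁ := hW₁.continuousOn
  have cW₂ := hW₂.conjugate.continuousOn
  have r1 : inner ℂ e₂ (weightL 2 V₁) =
      ∫ x in (0 : ℝ)..1, ((1 - x : ℝ) : ℂ) ^ 2 * (W₁ x * conj (f₂ x)) := by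
    rw [inner_weightL]
    refine intervalIntegral.integral_congr_ae ?_
    filter_upwards [he₂, hV₁] with x h1 h2 hx
    rw [h1 hx, h2 hx]
  have r2 : inner ℂ V₂ (weightL 2 e₁) =
      ∫ x in (0 : ℝ)..1, ((1 - x : ℝ) : ℂ) ^ 2 * (f₁ x * conj (W₂ x)) := by
    rw [inner_weightL]
    refine intervalIntegral.integral_congr_ae ?_
    filter_upwards [he₁, hV₂] with x h1 h2 hx
    rw [h1 hx, h2 hx]
  have r3 : inner ℂ V₂ (weightL 1 V₁) =
      ∫ x in (0 : ℝ)..1, ((1 - x : ℝ) : ℂ) ^ 1 * (W₁ x * conj (W₂ x)) := by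
    rw [inner_weightL]
    refine intervalIntegral.integral_congr_ae ?_
    filter_upwards [hV₁, hV₂] with x h1 h2 hx
    rw [h1 hx, h2 hx]
  have i1 : IntervalIntegrable (fun x : ℝ => ((1 - x : ℝ) : ℂ) ^ 2 * (W₁ x * conj (f₂ x)))
      volume 0 1 := ContinuousOn.intervalIntegrable (by fun_prop)
  have i2 : IntervalIntegrable (fun x : ℝ => ((1 - x : ℝ) : ℂ) ^ 2 * (f₁ x * conj (W₂ x)))
      volume 0 1 := ContinuousOn.intervalIntegrable (by fun_prop)
  have i3 : IntervalIntegrable (fun x : ℝ => ((1 - x : ℝ) : ℂ) ^ 1 * (W₁ x * conj (W₂ x)))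
      volume 0 1 := ContinuousOn.intervalIntegrable (by fun_prop)
  rw [r1, r2, r3, ← intervalIntegral.integral_add i1 i2, ← sub_eq_zero,
    ← intervalIntegral.integral_const_mul, ← intervalIntegral.integral_sub (i1.add i2)
    (i3.const_mul 2)]
  simp only [h01, h02, map_zero, mul_zero, sub_self, Complex.ofReal_zero] at key
  norm_num at key
  rw [← key]
  refine intervalIntegral.integral_congr fun x _ => ?_
  push_cast
  ring

/-- Integrate the derivative of `(1 - x)² |e|²`. The only surviving boundary term is at 0, and this
is where the trace enters. -/
theorem trace_identity {e o V : L2} {c : ℂ} (h : IsBoundaryChain e o V c) :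
    inner ℂ o (weightL 2 e) + inner ℂ e (weightL 2 o) =
      2 * inner ℂ e (weightL 1 e) - ((‖c‖ ^ 2 : ℝ) : ℂ) := by
  obtain ⟨f, W, hf, -, hc, -, he, -⟩ := h
  have key := ((isPrimitiveOn_one_sub_pow 2 0 1).mul (hf.conjugate.mul hf)).integral_eq
  have cf := hf.continuousOn
  have cf' := hf.conjugate.continuousOn
  have r1 : inner ℂ o (weightL 2 e) =
      ∫ x in (0 : ℝ)..1, ((1 - x : ℝ) : ℂ) ^ 2 * (f x * conj (o x)) := by
    rw [inner_weightL]
    refine intervalIntegral.integral_congr_ae ?_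
    filter_upwards [he] with x h1 hx
    rw [h1 hx]
  have r2 : inner ℂ e (weightL 2 o) =
      ∫ x in (0 : ℝ)..1, ((1 - x : ℝ) : ℂ) ^ 2 * (o x * conj (f x)) := by
    rw [inner_weightL]
    refine intervalIntegral.integral_congr_ae ?_
    filter_upwards [he] with x h1 hx
    rw [h1 hx]
  have r3 : inner ℂ e (weightL 1 e) =
      ∫ x in (0 : ℝ)..1, ((1 - x : ℝ) : ℂ) ^ 1 * (f x * conj (f x)) := by
    rw [inner_weightL]
    refine intervalIntegral.integral_congr_ae ?_
    filter_upwards [he] with x h1 hx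
    rw [h1 hx]
  have i1 : IntervalIntegrable (fun x : ℝ => ((1 - x : ℝ) : ℂ) ^ 2 * (f x * conj (o x)))
      volume 0 1 := (hf.conjugate.integrable.continuousOn_mul cf).continuousOn_mul (by fun_prop)
  have i2 : IntervalIntegrable (fun x : ℝ => ((1 - x : ℝ) : ℂ) ^ 2 * (o x * conj (f x)))
      volume 0 1 := (hf.integrable.mul_continuousOn cf').continuousOn_mul (by fun_prop)
  have i3 : IntervalIntegrable (fun x : ℝ => ((1 - x : ℝ) : ℂ) ^ 1 * (f x * conj (f x)))
      volume 0 1 := ContinuousOn.intervalIntegrable (by fun_prop)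
  have hcc : ((‖c‖ ^ 2 : ℝ) : ℂ) = conj c * c := by
    rw [mul_comm, Complex.mul_conj, Complex.normSq_eq_norm_sq]
  simp only [hc, sub_self, Complex.ofReal_zero, sub_zero, Complex.ofReal_one, one_pow, one_mul,
    ne_eq, OfNat.ofNat_ne_zero, not_false_eq_true, zero_pow, zero_mul, zero_sub] at key
  rw [r1, r2, r3, hcc, ← intervalIntegral.integral_add i1 i2, sub_eq_add_neg, ← key,
    ← intervalIntegral.integral_const_mul, ← intervalIntegral.integral_add (i3.const_mul 2)]
  · refine intervalIntegral.integral_congr fun x _ => ?_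
    push_cast
    ring
  · exact ((isPrimitiveOn_one_sub_pow 2 0 1).mul (hf.conjugate.mul hf)).integrable

/-- Integrate the derivative of `(1 - x) conj(V) e`, which vanishes at both ends. This eliminates
`o` in favour of `e` and `V`. -/
theorem mixed_identity {e o V : L2} {c : ℂ} (h : IsBoundaryChain e o V c) :
    inner ℂ V (weightL 1 o) + inner ℂ e (weightL 1 e) = inner ℂ V (weightL 0 e) := by
  obtain ⟨f, W, hf, hW, -, h0, he, hV⟩ := h
  have key := ((isPrimitiveOn_one_sub_pow 1 0 1).mul (hW.conjugate.mul hf)).integral_eq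
  have cf := hf.continuousOn
  have cf' := hf.conjugate.continuousOn
  have cW := hW.conjugate.continuousOn
  have r1 : inner ℂ V (weightL 1 o) =
      ∫ x in (0 : ℝ)..1, ((1 - x : ℝ) : ℂ) ^ 1 * (o x * conj (W x)) := by
    rw [inner_weightL]
    refine intervalIntegral.integral_congr_ae ?_
    filter_upwards [hV] with x h1 hx
    rw [h1 hx]
  have r2 : inner ℂ e (weightL 1 e) =
      ∫ x in (0 : ℝ)..1, ((1 - x : ℝ) : ℂ) ^ 1 * (f x * conj (f x)) := by
    rw [inner_weightL]
    refine intervalIntegral.integral_congr_ae ?_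
    filter_upwards [he] with x h1 hx
    rw [h1 hx]
  have r3 : inner ℂ V (weightL 0 e) =
      ∫ x in (0 : ℝ)..1, ((1 - x : ℝ) : ℂ) ^ 0 * (f x * conj (W x)) := by
    rw [inner_weightL]
    refine intervalIntegral.integral_congr_ae ?_
    filter_upwards [he, hV] with x h1 h2 hx
    rw [h1 hx, h2 hx]
  have i1 : IntervalIntegrable (fun x : ℝ => ((1 - x : ℝ) : ℂ) ^ 1 * (o x * conj (W x)))
      volume 0 1 := (hf.integrable.mul_continuousOn cW).continuousOn_mul (by fun_prop)
  have i2 : IntervalIntegrable (fun x : ℝ => ((1 - x : ℝ) : ℂ) ^ 1 * (f x * conj (f x)))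
      volume 0 1 := ContinuousOn.intervalIntegrable (by fun_prop)
  have i3 : IntervalIntegrable (fun x : ℝ => ((1 - x : ℝ) : ℂ) ^ 0 * (f x * conj (W x)))
      volume 0 1 := ContinuousOn.intervalIntegrable (by fun_prop)
  simp only [h0, map_zero, sub_self, Complex.ofReal_zero, zero_mul, mul_zero, pow_one] at key
  rw [r1, r2, r3, ← intervalIntegral.integral_add i1 i2, ← sub_eq_zero,
    ← intervalIntegral.integral_sub (i1.add i2) i3, ← key]
  refine intervalIntegral.integral_congr fun x _ => ?_
  push_cast
  ring

end IsBoundaryChain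

/-! ### Increments of a weak solution form boundary chains -/

theorem integral_indicator_Ioi_mul_deriv {θ : ℝ → ℂ} (hθ : ContDiff ℝ ∞ θ)
    (hc : HasCompactSupport θ) (c : ℂ) :
    ∫ x, (Set.Ioi (0 : ℝ)).indicator (fun _ => c) x * deriv θ x = -(c * θ 0) := by
  have h : ∀ x, (Set.Ioi (0 : ℝ)).indicator (fun _ => c) x * deriv θ x =
      (Set.Ioi (0 : ℝ)).indicator (fun x => c * deriv θ x) x := fun x => by
    by_cases hx : x ∈ Set.Ioi (0 : ℝ)
    · simp only [Set.indicator_of_mem hx]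
    · simp only [Set.indicator_of_notMem hx, zero_mul]
  simp only [h]
  rw [integral_indicator measurableSet_Ioi, integral_const_mul,
    integral_Ioi_of_hasDerivAt_of_tendsto (f := θ) (m := 0) hθ.continuous.continuousWithinAt
    (fun x _ => (hθ.differentiable (by simp) x).hasDerivAt)
    ((hθ.continuous_deriv (by simp)).integrable_of_hasCompactSupport hc.deriv).integrableOn]
  · ring
  · exact hc.is_zero_at_infty.mono_left atTop_le_cocompact

theorem inner_testL2_conj_right {θ : ℝ → ℂ} (hc : Continuous θ) (hs : HasCompactSupport θ)
    (f : L2) : inner ℂ f (testL2 (fun x => conj (θ x)) (Complex.continuous_conj.comp hc)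
      (hasCompactSupport_conj hs)) = conj (∫ x, f x * θ x) := by
  rw [← inner_conj_symm, ← integral_mul_eq_inner hc hs]

namespace WeakSolution

variable {Ψ : ℝ → H1} {f : ℝ → ℂ}

theorem weak_smooth (h : WeakSolution Ψ f) {θ : ℝ → ℂ} (hθ : ContDiff ℝ ∞ θ)
    (hc : HasCompactSupport θ) (a b : ℝ) :
    ∫ x, fnL (Ψ b - Ψ a) x * θ x =
      -Complex.I * (∫ x, (∫ t in a..b, derL (Ψ t) : L2) x * deriv θ x) +
        Complex.I * ((∫ t in a..b, f t) * θ 0) := by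
  have h1 := h.weak (testH1 _ (contDiff_conj hθ) (hasCompactSupport_conj hc)) a b
  have hd := hθ.continuous_deriv (n := ∞) (by simp)
  have hdc : derL (testH1 _ (contDiff_conj hθ) (hasCompactSupport_conj hc)) =
      testL2 (fun x => conj (deriv θ x)) (Complex.continuous_conj.comp hd)
        (hasCompactSupport_conj hc.deriv) := by
    rw [derL_testH1]
    congr 1
    exact funext (deriv_conj hθ)
  rw [(isContinuousRep_testH1 _ _).evalL_eq, fnL_testH1, hdc,
    inner_testL2_conj_right hθ.continuous hc, inner_testL2_conj_right hd hc.deriv, ← map_sub] at h1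
  have h2 := congrArg conj h1
  simp only [map_sub, map_mul, Complex.conj_conj, Complex.conj_I, RCLike.inner_apply] at h2
  rw [map_sub, h2]
  ring

/-- Integrated over `[a, b]`, the equation reads `P' = -i w - G δ`, with `P` and `G` the time
integrals of derivative and source. The step function with jump `G` absorbs the delta. -/
theorem ae_primitive (h : WeakSolution Ψ f) (a b : ℝ) {w : ℝ → ℂ}
    (hw : IsContinuousRep w (Ψ b - Ψ a)) : ∃ k : ℂ,
    (fun x => (∫ t in a..b, derL (Ψ t) : L2) x +
      (Set.Ioi (0 : ℝ)).indicator (fun _ => ∫ t in a..b, f t) x) =ᵐ[volume]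
      fun x => k + ∫ t in (0 : ℝ)..x, -Complex.I * w t := by
  set P : L2 := ∫ t in a..b, derL (Ψ t) with hP
  set G := ∫ t in a..b, f t with hG
  have hI : LocallyIntegrable ((Set.Ioi (0 : ℝ)).indicator fun _ => G) volume :=
    (locallyIntegrable_const G).indicator measurableSet_Ioi
  refine ae_eq_primitive_of_weak_deriv ((L2.locallyIntegrable P).add hI)
    (continuous_const.mul hw.1).locallyIntegrable fun θ hθ hc => ?_
  have hd := hθ.continuous_deriv (n := ∞) (by simp)
  have h1 := h.weak_smooth hθ hc a b
  have h2 : ∫ x, -Complex.I * w x * θ x = -Complex.I * ∫ x, fnL (Ψ b - Ψ a) x * θ x := by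
    rw [← integral_const_mul]
    refine integral_congr_ae ?_
    filter_upwards [hw.2] with x hx
    rw [hx, fnL_apply, mul_assoc]
  simp only [add_mul]
  rw [integral_add, integral_indicator_Ioi_mul_deriv hθ hc, h2, h1]
  · linear_combination (-(G * θ 0) + ∫ x, P x * deriv θ x) * Complex.I_mul_I
  · exact integrable_L2_mul P hd hc.deriv
  · exact hI.integrable_smul_right_of_hasCompactSupport hd hc.deriv

/-- Subtracting the values of `ae_primitive` at `x` and `-x` cancels the unknown constant and makes
the primitive vanish at the origin. The jump is seen only from the right, so it contributes a
constant on `(0, 1]`; the factor `i` undoes the `-i` of the equation. -/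
theorem isBoundaryChain (h : WeakSolution Ψ f) (a b : ℝ) :
    IsBoundaryChain (fnL (Ψ b - Ψ a) + reflL (fnL (Ψ b - Ψ a)))
      (derL (Ψ b - Ψ a) - reflL (derL (Ψ b - Ψ a)))
      (Complex.I • ((∫ t in a..b, derL (Ψ t)) - reflL (∫ t in a..b, derL (Ψ t)) +
        (∫ t in a..b, f t) • unitIndicator)) (2 * evalL 0 (Ψ b - Ψ a)) := by
  obtain ⟨w, hw⟩ := exists_isContinuousRep (Ψ b - Ψ a)
  obtain ⟨k, hk⟩ := h.ae_primitive a b hw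
  have negq : Measure.QuasiMeasurePreserving (Neg.neg : ℝ → ℝ) volume volume :=
    (Measure.measurePreserving_neg volume).quasiMeasurePreserving
  set P : L2 := ∫ t in a..b, derL (Ψ t) with hP
  set G := ∫ t in a..b, f t with hG
  set W := Ψ b - Ψ a with hW
  have hcw : Continuous fun x => w x + w (-x) := hw.1.add (hw.1.comp continuous_neg)
  refine ⟨fun x => w x + w (-x), fun x => ∫ t in (0 : ℝ)..x, (w t + w (-t)), ?_, ?_, ?_, ?_, ?_, ?_⟩
  · refine ⟨L2.intervalIntegrable _ _ _, fun x _ => ?_⟩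
    have hneg : ∫ t in (0 : ℝ)..x, derL W (-t) = -(w (-x) - w 0) := by
      rw [intervalIntegral.integral_comp_neg fun t => derL W t, hw.sub_eq_integral, neg_zero,
        intervalIntegral.integral_symm]
    have hx : ∫ t in (0 : ℝ)..x, (derL W - reflL (derL W) : L2) t =
        ∫ t in (0 : ℝ)..x, (derL W t - derL W (-t)) := by
      refine intervalIntegral.integral_congr_ae ?_
      filter_upwards [Lp.coeFn_sub (derL W) (reflL (derL W)), coeFn_reflL (derL W)] with t h1 h2 _
      rw [h1, Pi.sub_apply, h2]
    have hi : IntervalIntegrable (fun t => derL W (-t)) volume 0 x := by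
      have := (L2.intervalIntegrable (derL W) 0 (-x)).comp_mul_left (c := -1)
      simpa using this
    rw [hx, intervalIntegral.integral_sub (L2.intervalIntegrable _ _ _) hi, hneg,
      ← hw.sub_eq_integral, neg_zero]
    ring
  · refine ⟨hcw.intervalIntegrable _ _, fun x _ => ?_⟩
    rw [intervalIntegral.integral_same, zero_add]
  · rw [hw.evalL_eq]
    simp only [neg_zero]
    ring
  · exact intervalIntegral.integral_same
  · filter_upwards [Lp.coeFn_add (fnL W) (reflL (fnL W)), coeFn_reflL (fnL W), hw.2,
      negq.ae hw.2] with x h1 h2 h3 h4 _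
    rw [h1, Pi.add_apply, h2, h3, h4]
    rfl
  · filter_upwards [Lp.coeFn_smul Complex.I (P - reflL P + G • unitIndicator),
      Lp.coeFn_add (P - reflL P) (G • unitIndicator), Lp.coeFn_sub P (reflL P), coeFn_reflL P,
      Lp.coeFn_smul G unitIndicator, coeFn_unitIndicator, hk, negq.ae hk] with
      x h1 h2 h3 h4 h5 h6 h7 h8 hx
    rw [Set.uIoc_of_le zero_le_one] at hx
    have hx1 : x ∈ Set.Ioi (0 : ℝ) := hx.1
    have hx2 : -x ∉ Set.Ioi (0 : ℝ) := by
      simp only [Set.mem_Ioi, not_lt, Left.neg_nonpos_iff]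
      exact hx.1.le
    rw [h1, Pi.smul_apply, h2, Pi.add_apply, h3, Pi.sub_apply, h4, h5, Pi.smul_apply, h6,
      Set.indicator_of_mem hx]
    rw [Set.indicator_of_mem hx1] at h7
    rw [Set.indicator_of_notMem hx2] at h8
    have hn : ∫ t in (0 : ℝ)..-x, w t = -∫ t in (0 : ℝ)..x, w (-t) := by
      rw [intervalIntegral.integral_comp_neg, neg_zero, intervalIntegral.integral_symm]
    rw [intervalIntegral.integral_const_mul] at h7 h8
    rw [hn] at h8
    have hs : ∫ t in (0 : ℝ)..x, (w t + w (-t)) =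
        (∫ t in (0 : ℝ)..x, w t) + ∫ t in (0 : ℝ)..x, w (-t) :=
      intervalIntegral.integral_add (hw.1.intervalIntegrable _ _)
        ((hw.1.comp continuous_neg).intervalIntegrable _ _)
    rw [hs, smul_eq_mul, smul_eq_mul]
    linear_combination Complex.I * h7 - Complex.I * h8 -
      ((∫ t in (0 : ℝ)..x, w t) + ∫ t in (0 : ℝ)..x, w (-t)) * Complex.I_mul_I

end WeakSolution

/-! ### Momentum flux and hidden regularity of the trace -/

/-- Momentum flux: the derivative of the momentum of a boundary chain driven by `g`. -/
theorem IsBoundaryChain.flux_identity {e o V : L2} {c : ℂ} (h : IsBoundaryChain e o V c) (g : ℂ) :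
    (inner ℂ (o + g • unitIndicator)
      ((2 : ℂ) • weightL 2 e - (2 : ℂ) • weightL 1 V)).re =
      4 * (inner ℂ e (weightL 1 e)).re - ‖c‖ ^ 2 - 2 * (inner ℂ V (weightL 0 e)).re +
        (inner ℂ (g • unitIndicator) ((2 : ℂ) • weightL 2 e - (2 : ℂ) • weightL 1 V)).re := by
  have h1 := congrArg Complex.re h.trace_identity
  have h2 := congrArg Complex.re h.mixed_identity
  have h3 : (inner ℂ e (weightL 2 o)).re = (inner ℂ o (weightL 2 e)).re := by
    rw [← inner_weightL_left, ← inner_conj_symm, Complex.conj_re]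
  have h4 : (inner ℂ V (weightL 1 o)).re = (inner ℂ o (weightL 1 V)).re := by
    rw [← inner_weightL_left, ← inner_conj_symm, Complex.conj_re]
  rw [inner_add_left, Complex.add_re, inner_sub_right, inner_smul_right, inner_smul_right]
  have two_re : ∀ z : ℂ, (2 * z).re = 2 * z.re := fun z => by simp
  simp only [Complex.add_re, Complex.sub_re, Complex.ofReal_re, two_re] at h1 h2 ⊢
  linarith

theorem re_inner_le {E : Type*} [NormedAddCommGroup E] [InnerProductSpace ℂ E] (x y : E) :
    |(inner ℂ x y).re| ≤ ‖x‖ * ‖y‖ :=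
  (Complex.abs_re_le_norm _).trans (norm_inner_le_norm _ _)

/-- Every term of the flux identity is bounded by Cauchy-Schwarz, the weights being contractions,
except the one that is a time derivative: it will be integrated instead. -/
theorem IsBoundaryChain.norm_sq_le {e o V : L2} {c : ℂ} (h : IsBoundaryChain e o V c) (g : ℂ) :
    ‖c‖ ^ 2 ≤ -(inner ℂ (o + g • unitIndicator)
      ((2 : ℂ) • weightL 2 e - (2 : ℂ) • weightL 1 V)).re +
      4 * ‖e‖ ^ 2 + 2 * (‖V‖ * ‖e‖) + ‖g‖ * (2 * ‖e‖ + 2 * ‖V‖) := by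
  have h1 := h.flux_identity g
  have b1 := (abs_le.mp (re_inner_le e (weightL 1 e))).2
  have b2 := (abs_le.mp (re_inner_le V (weightL 0 e))).1
  have b3 := (abs_le.mp (re_inner_le (g • unitIndicator)
    ((2 : ℂ) • weightL 2 e - (2 : ℂ) • weightL 1 V))).2
  have w1 := mul_le_mul_of_nonneg_left (norm_weightL_le 1 e) (norm_nonneg e)
  have w0 := mul_le_mul_of_nonneg_left (norm_weightL_le 0 e) (norm_nonneg V)
  have w3 : ‖g • unitIndicator‖ * ‖(2 : ℂ) • weightL 2 e - (2 : ℂ) • weightL 1 V‖ ≤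
      ‖g‖ * (2 * ‖e‖ + 2 * ‖V‖) := by
    rw [norm_smul, norm_unitIndicator, mul_one]
    refine mul_le_mul_of_nonneg_left ((norm_sub_le _ _).trans (add_le_add ?_ ?_)) (norm_nonneg g)
    · rw [norm_smul, Complex.norm_ofNat]
      exact mul_le_mul_of_nonneg_left (norm_weightL_le 2 e) (by norm_num)
    · rw [norm_smul, Complex.norm_ofNat]
      exact mul_le_mul_of_nonneg_left (norm_weightL_le 1 V) (by norm_num)
  nlinarith

/-- Change of the momentum between two boundary chains. -/
theorem IsBoundaryChain.momentum_sub {e₁ o₁ V₁ e₂ o₂ V₂ : L2} {c₁ c₂ : ℂ}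
    (h₁ : IsBoundaryChain e₁ o₁ V₁ c₁) (h₂ : IsBoundaryChain e₂ o₂ V₂ c₂) :
    (inner ℂ e₂ (weightL 2 V₂)).im - (inner ℂ e₁ (weightL 2 V₁)).im =
      -(inner ℂ (V₂ - V₁) (weightL 2 (e₂ + e₁) - (2 : ℂ) • weightL 1 V₂)).im := by
  have h := congrArg Complex.im (h₁.cross_identity h₂)
  have sw : ∀ n (x y : L2), (inner ℂ x (weightL n y)).im = -(inner ℂ y (weightL n x)).im := by
    intro n x y
    rw [← inner_weightL_left, ← inner_conj_symm, Complex.conj_im]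
  have hz : (inner ℂ V₂ (weightL 1 V₂)).im = 0 := by
    have := sw 1 V₂ V₂
    linarith
  rw [map_add, inner_sub_left, inner_sub_right, inner_sub_right, inner_add_right, inner_add_right,
    inner_smul_right, inner_smul_right]
  have two_im : ∀ z : ℂ, (2 * z).im = 2 * z.im := fun z => by simp
  simp only [Complex.add_im, Complex.sub_im, two_im] at h ⊢
  have s1 := sw 2 V₂ e₂
  have s2 := sw 2 V₁ e₂
  have s3 := sw 2 V₁ e₁
  have s4 := sw 1 V₁ V₂
  linarith

namespace WeakSolution

variable {Ψ : ℝ → H1} {f : ℝ → ℂ}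

/-- Hidden regularity: the trace at the origin of an increment of the solution is controlled, in
mean square, by the `L²` norm of the increment. -/
theorem integral_trace_increment_le (H : WeakSolution Ψ f) {h a b : ℝ} (hab : a ≤ b)
    {η κ L : ℝ} (hη : ∀ t ∈ Set.Icc a b, ‖fnL (Ψ (t + h) - Ψ t)‖ ≤ η)
    (hκ : ∀ t ∈ Set.Icc a b, ‖∫ r in t..(t + h), derL (Ψ r)‖ ≤ κ)
    (hκ' : ∀ t ∈ Set.Icc a b, ‖∫ r in t..(t + h), f r‖ ≤ κ)
    (hL : ∀ t ∈ Set.Icc a b, ‖f (t + h) - f t‖ ≤ L * ‖evalL 0 (Ψ (t + h) - Ψ t)‖) :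
    2 * ∫ t in a..b, ‖evalL 0 (Ψ (t + h) - Ψ t)‖ ^ 2 ≤
      12 * η * κ + (b - a) * (16 * η ^ 2 + 12 * η * κ + L ^ 2 * (4 * η + 6 * κ) ^ 2 / 8) := by
  set W : ℝ → H1 := fun t => Ψ (t + h) - Ψ t with hW
  set P : ℝ → L2 := fun t => ∫ r in t..(t + h), derL (Ψ r) with hP
  set G : ℝ → ℂ := fun t => ∫ r in t..(t + h), f r with hG
  set e : ℝ → L2 := fun t => fnL (W t) + reflL (fnL (W t)) with he
  set o : ℝ → L2 := fun t => derL (W t) - reflL (derL (W t)) with ho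
  set V : ℝ → L2 := fun t => Complex.I • (P t - reflL (P t) + G t • unitIndicator) with hV
  have chain : ∀ t, IsBoundaryChain (e t) (o t) (V t) (2 * evalL 0 (W t)) := fun t =>
    H.isBoundaryChain t (t + h)
  have hWc : Continuous W := (H.continuous_path.comp (continuous_id.add continuous_const)).sub
    H.continuous_path
  have hec : Continuous e := (fnL.continuous.comp hWc).add
    (reflL.continuous.comp (fnL.continuous.comp hWc))
  have hoc : Continuous o := (derL.continuous.comp hWc).sub
    (reflL.continuous.comp (derL.continuous.comp hWc))
  have hPd : ∀ t, HasDerivAt P (derL (W t)) t := fun t => by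
    have := hasDerivAt_integral_window H.continuous_der h t
    rwa [← map_sub] at this
  have hGd : ∀ t, HasDerivAt G (f (t + h) - f t) t :=
    hasDerivAt_integral_window H.continuous_source h
  have hVd : ∀ t, HasDerivAt V
      (Complex.I • (o t + (f (t + h) - f t) • unitIndicator)) t := fun t =>
    (((hPd t).sub ((reflL.restrictScalars ℝ).hasFDerivAt.comp_hasDerivAt t (hPd t))).add
      ((hGd t).smul_const unitIndicator)).const_smul Complex.I
  have hVc : Continuous V := continuous_iff_continuousAt.mpr fun t => (hVd t).continuousAt
  have hgc : Continuous fun t => f (t + h) - f t :=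
    (H.continuous_source.comp (continuous_id.add continuous_const)).sub H.continuous_source
  set Q : ℝ → ℝ := fun t => (inner ℂ (e t) (weightL 2 (V t))).im with hQ
  set D : ℝ → ℝ := fun t => (inner ℂ (o t + (f (t + h) - f t) • unitIndicator)
      ((2 : ℂ) • weightL 2 (e t) - (2 : ℂ) • weightL 1 (V t))).re with hD
  have hDc : Continuous D := by
    have h1 : Continuous fun t => (2 : ℂ) • weightL 2 (e t) - (2 : ℂ) • weightL 1 (V t) := by
      fun_prop
    exact Complex.continuous_re.comp ((hoc.add (hgc.smul continuous_const)).inner h1)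
  have hQd : ∀ t, HasDerivAt Q (D t) t := by
    intro t
    -- `e` is only continuous in time, so the increment of the momentum is expressed through `V s -
    -- V t`, which is differentiable and vanishes at `s = t`.
    have e1 : Q = fun s => Q t + -(inner ℂ (V s - V t)
        (weightL 2 (e s + e t) - (2 : ℂ) • weightL 1 (V s))).im := by
      ext s
      rw [← (chain t).momentum_sub (chain s)]
      ring
    rw [e1]
    have cc : Continuous fun s => weightL 2 (e s + e t) - (2 : ℂ) • weightL 1 (V s) := by
      fun_prop
    have d1 := hasDerivAt_inner_of_eq_zero ((hVd t).sub_const (V t)) (sub_self _) cc.continuousAt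
    have d2 := (Complex.imCLM.hasFDerivAt.comp_hasDerivAt t d1).neg.const_add (Q t)
    refine d2.congr_deriv ?_
    rw [Complex.imCLM_apply, inner_smul_left, Complex.conj_I, map_add,
      ← two_smul ℂ (weightL 2 (e t)), neg_mul, Complex.neg_im, neg_neg, Complex.I_mul_im]
  have heb : ∀ t ∈ Set.Icc a b, ‖e t‖ ≤ 2 * η := fun t ht => by
    have h1 := norm_add_le (fnL (W t)) (reflL (fnL (W t)))
    rw [norm_reflL] at h1
    have h2 := hη t ht
    simp only [he]
    linarith
  have hVb : ∀ t ∈ Set.Icc a b, ‖V t‖ ≤ 3 * κ := fun t ht => by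
    have h1 := norm_add_le (P t - reflL (P t)) (G t • unitIndicator)
    have h2 := norm_sub_le (P t) (reflL (P t))
    rw [norm_reflL] at h2
    rw [norm_smul, norm_unitIndicator, mul_one] at h1
    have h3 := hκ t ht
    have h4 := hκ' t ht
    simp only [hV, norm_smul, Complex.norm_I, one_mul]
    linarith
  have hη0 : 0 ≤ η := (norm_nonneg _).trans (hη a ⟨le_rfl, hab⟩)
  have hκ0 : 0 ≤ κ := (norm_nonneg _).trans (hκ a ⟨le_rfl, hab⟩)
  set K : ℝ := 16 * η ^ 2 + 12 * η * κ + L ^ 2 * (4 * η + 6 * κ) ^ 2 / 8 with hK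
  have hpt : ∀ t ∈ Set.Icc a b, 2 * ‖evalL 0 (W t)‖ ^ 2 ≤ -D t + K := by
    intro t ht
    have h1 := (chain t).norm_sq_le (f (t + h) - f t)
    rw [norm_mul, Complex.norm_ofNat] at h1
    have h2 := heb t ht
    have h3 := hVb t ht
    have h4 := hL t ht
    have n1 := norm_nonneg (e t)
    have n2 := norm_nonneg (V t)
    have q1 : ‖e t‖ ^ 2 ≤ (2 * η) ^ 2 := pow_le_pow_left₀ n1 h2 2
    have q2 : ‖V t‖ * ‖e t‖ ≤ (3 * κ) * (2 * η) := mul_le_mul h3 h2 n1 (by positivity)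
    have q3 : ‖f (t + h) - f t‖ * (2 * ‖e t‖ + 2 * ‖V t‖) ≤
        L * ‖evalL 0 (W t)‖ * (4 * η + 6 * κ) :=
      mul_le_mul h4 (by linarith) (by positivity) ((norm_nonneg _).trans h4)
    -- With `w` the trace and `X = 4η + 6κ`, this gives `L w X ≤ 2 w² + L² X² / 8`. Half of the
    -- available `4 w²` (the chain has boundary value `2 w`) absorbs the source.
    have q4 := sq_nonneg (4 * ‖evalL 0 (W t)‖ - L * (4 * η + 6 * κ))
    change _ ≤ -D t + _ + _ + _ at h1
    rw [hK]
    nlinarith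
  have hlc : Continuous fun t => 2 * ‖evalL 0 (W t)‖ ^ 2 := by fun_prop
  have hrc : Continuous fun t => -D t + K := by fun_prop
  have hint := intervalIntegral.integral_mono_on (μ := volume) hab (hlc.intervalIntegrable _ _)
    (hrc.intervalIntegrable _ _) hpt
  have hsplit : ∫ t in a..b, (-D t + K) = -(Q b - Q a) + (b - a) * K := by
    rw [intervalIntegral.integral_add (f := fun t => -D t) (hDc.neg.intervalIntegrable _ _)
      (by simp), intervalIntegral.integral_neg, intervalIntegral.integral_eq_sub_of_hasDerivAt
      (fun t _ => hQd t) (hDc.intervalIntegrable _ _), intervalIntegral.integral_const, smul_eq_mul]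
  rw [intervalIntegral.integral_const_mul, hsplit] at hint
  have hQb : ∀ t ∈ Set.Icc a b, |Q t| ≤ 6 * η * κ := fun t ht => by
    have h1 : |Q t| ≤ ‖e t‖ * ‖weightL 2 (V t)‖ :=
      (Complex.abs_im_le_norm _).trans (norm_inner_le_norm _ _)
    have h2 : ‖e t‖ * ‖weightL 2 (V t)‖ ≤ (2 * η) * (3 * κ) :=
      mul_le_mul (heb t ht) ((norm_weightL_le _ _).trans (hVb t ht)) (norm_nonneg _) (by positivity)
    linarith
  have qa := abs_le.mp (hQb a ⟨le_rfl, hab⟩)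
  have qb := abs_le.mp (hQb b ⟨hab, le_rfl⟩)
  linarith [qa.2, qb.1]

end WeakSolution

theorem norm_integral_window_le {E : Type*} [NormedAddCommGroup E] [NormedSpace ℝ E] {p : ℝ → E}
    {t h M : ℝ} (hh : 0 ≤ h) (hM : ∀ s ∈ Set.Icc t (t + h), ‖p s‖ ≤ M) :
    ‖∫ r in t..(t + h), p r‖ ≤ M * h := by
  have := intervalIntegral.norm_integral_le_of_norm_le_const (f := p) (a := t) (b := t + h) (C := M)
    fun s hs => hM s (by
      rw [Set.uIoc_of_le (by linarith)] at hs
      exact ⟨hs.1.le, hs.2⟩)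
  rwa [add_sub_cancel_left, abs_of_nonneg hh] at this

theorem norm_derL_le (Φ : H1) : ‖derL Φ‖ ≤ ‖Φ‖ := by
  have h1 : ‖(Φ : WithLp 2 (L2 × L2))‖ ^ 2 = ‖fnL Φ‖ ^ 2 + ‖derL Φ‖ ^ 2 :=
    WithLp.prod_norm_sq_eq_of_L2 (Φ : WithLp 2 (L2 × L2))
  refine abs_le_of_sq_le_sq' ?_ (norm_nonneg _) |>.2
  rw [Submodule.coe_norm, h1]
  nlinarith [sq_nonneg ‖fnL Φ‖]

theorem norm_evalL_le (x : ℝ) (Φ : H1) : ‖evalL x Φ‖ ≤ 2 * ‖Φ‖ := by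
  obtain ⟨v, hv⟩ := exists_isContinuousRep Φ
  rw [hv.evalL_eq]
  exact hv.norm_le_two_mul x

namespace WeakSolution

variable {Ψ : ℝ → H1} {f : ℝ → ℂ}

/-- The trace at the origin of a weak solution with Lipschitz source has mean square increments
of order `o(h)`. -/
theorem integral_trace_increment_isLittleO (H : WeakSolution Ψ f) {a b L : ℝ} (hab : a ≤ b)
    (hL : ∀ s ∈ Set.Icc a (b + 1), ∀ t ∈ Set.Icc a (b + 1),
      ‖f s - f t‖ ≤ L * ‖evalL 0 (Ψ s) - evalL 0 (Ψ t)‖) {ε : ℝ} (hε : 0 < ε) :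
    ∃ δ > 0, δ ≤ 1 ∧ ∀ h, 0 < h → h < δ →
      ∫ t in a..b, ‖evalL 0 (Ψ (t + h)) - evalL 0 (Ψ t)‖ ^ 2 ≤ ε * h := by
  obtain ⟨M₁, hM₁⟩ := (isCompact_Icc (a := a) (b := b + 1)).exists_bound_of_continuousOn
    H.continuous_der.continuousOn
  obtain ⟨M₂, hM₂⟩ := (isCompact_Icc (a := a) (b := b + 1)).exists_bound_of_continuousOn
    H.continuous_source.continuousOn
  have ha : a ∈ Set.Icc a (b + 1) := ⟨le_rfl, by linarith⟩
  set M := max M₁ M₂ with hM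
  have hM0 : 0 ≤ M := (norm_nonneg _).trans ((hM₁ a ha).trans (le_max_left _ _))
  -- With `κ = M h`, this collects the bounds `12 η κ ≤ 6 (η² + κ²)` and `(4η + 6κ)² ≤ 72 (η² +
  -- κ²)`. The constant `K` below also includes the size of `η² + κ²` relative to `h ε / K`.
  set C : ℝ := 6 + (b - a) * (22 + 9 * L ^ 2) with hC
  have hC0 : 0 < C := by
    have : 0 ≤ b - a := sub_nonneg.mpr hab
    positivity
  set K : ℝ := C * (3 * M + M ^ 2 + 1) with hK
  have hK0 : 0 < K := by positivity
  obtain ⟨δ, hδ, hδΨ⟩ := Metric.uniformContinuousOn_iff.mp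
    ((isCompact_Icc (a := a) (b := b + 1)).uniformContinuousOn_of_continuous
      H.continuous_path.continuousOn) (ε / K) (by positivity)
  refine ⟨min (min δ 1) (ε / K), by positivity, (min_le_left _ _).trans (min_le_right _ _), ?_⟩
  intro h h0 hh
  have hhδ : h < δ := hh.trans_le ((min_le_left _ _).trans (min_le_left _ _))
  have hh1 : h < 1 := hh.trans_le ((min_le_left _ _).trans (min_le_right _ _))
  have hhε : h < ε / K := hh.trans_le (min_le_right _ _)
  have hmem : ∀ t ∈ Set.Icc a b, ∀ s ∈ Set.Icc t (t + h), s ∈ Set.Icc a (b + 1) :=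
    fun t ht s hs => ⟨ht.1.trans hs.1, by linarith [hs.2, ht.2]⟩
  have hmem' : ∀ t ∈ Set.Icc a b, t ∈ Set.Icc a (b + 1) ∧ t + h ∈ Set.Icc a (b + 1) :=
    fun t ht => ⟨hmem t ht t ⟨le_rfl, by linarith⟩, hmem t ht _ ⟨by linarith, le_rfl⟩⟩
  have hP : ∀ t ∈ Set.Icc a b, ‖∫ r in t..(t + h), derL (Ψ r)‖ ≤ M * h := fun t ht =>
    norm_integral_window_le h0.le fun s hs =>
      (hM₁ s (hmem t ht s hs)).trans (le_max_left _ _)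
  have hG : ∀ t ∈ Set.Icc a b, ‖∫ r in t..(t + h), f r‖ ≤ M * h := fun t ht =>
    norm_integral_window_le h0.le fun s hs =>
      (hM₂ s (hmem t ht s hs)).trans (le_max_right _ _)
  have hW : ∀ t ∈ Set.Icc a b, ‖Ψ (t + h) - Ψ t‖ ≤ ε / K := fun t ht => by
    have := hδΨ (t + h) (hmem' t ht).2 t (hmem' t ht).1 (by
      rw [Real.dist_eq, add_sub_cancel_left, abs_of_pos h0]
      exact hhδ)
    rw [dist_eq_norm] at this
    exact this.le
  -- The bound of `norm_sq_sub_le`: `M h` times `ε / K` from the derivative, and `M h` times `2 ε /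
  -- K` from the trace. Uniform continuity in `H1` is what makes `η²` an `o(h)`.
  set η : ℝ := √(3 * M * h * (ε / K)) with hη
  have hη2 : η ^ 2 = 3 * M * h * (ε / K) := Real.sq_sqrt (by positivity)
  have hq : ∀ t ∈ Set.Icc a b, ‖fnL (Ψ (t + h) - Ψ t)‖ ≤ η := by
    intro t ht
    refine Real.le_sqrt_of_sq_le ?_
    have h1 := H.norm_sq_sub_le t (t + h)
    rw [← map_sub, ← map_sub, ← map_sub] at h1
    have h2 := (norm_derL_le (Ψ (t + h) - Ψ t)).trans (hW t ht)
    have h3 := (norm_evalL_le 0 (Ψ (t + h) - Ψ t)).trans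
      (mul_le_mul_of_nonneg_left (hW t ht) two_pos.le)
    have h4 := mul_le_mul (hP t ht) h2 (norm_nonneg _) (by positivity)
    have h5 := mul_le_mul (hG t ht) h3 (norm_nonneg _) (by positivity)
    linarith
  have main := H.integral_trace_increment_le hab hq hP hG (L := L) fun t ht => by
    rw [map_sub]
    exact hL _ (hmem' t ht).2 _ (hmem' t ht).1
  simp only [map_sub] at main
  have hba : 0 ≤ b - a := sub_nonneg.mpr hab
  have y1 : 12 * η * (M * h) ≤ 6 * (η ^ 2 + (M * h) ^ 2) := by
    nlinarith [sq_nonneg (η - M * h)]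
  have y2 : (4 * η + 6 * (M * h)) ^ 2 ≤ 72 * (η ^ 2 + (M * h) ^ 2) := by
    nlinarith [sq_nonneg (6 * η - 4 * (M * h)), sq_nonneg η, sq_nonneg (M * h)]
  have y3 : 16 * η ^ 2 + 12 * η * (M * h) + L ^ 2 * (4 * η + 6 * (M * h)) ^ 2 / 8 ≤
      (22 + 9 * L ^ 2) * (η ^ 2 + (M * h) ^ 2) := by
    have := mul_le_mul_of_nonneg_left y2 (sq_nonneg L)
    nlinarith [sq_nonneg (M * h)]
  have y4 := mul_le_mul_of_nonneg_left y3 hba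
  have y5 : 2 * ∫ t in a..b, ‖evalL 0 (Ψ (t + h)) - evalL 0 (Ψ t)‖ ^ 2 ≤
      C * (η ^ 2 + (M * h) ^ 2) := by
    rw [hC]
    linarith
  have y6 : η ^ 2 + (M * h) ^ 2 ≤ (3 * M + M ^ 2 + 1) * (h * (ε / K)) := by
    rw [hη2]
    have : M ^ 2 * (h * h) ≤ M ^ 2 * (h * (ε / K)) := by gcongr
    have : 0 ≤ h * (ε / K) := by positivity
    nlinarith
  have y7 := mul_le_mul_of_nonneg_left y6 hC0.le
  have y8 : C * ((3 * M + M ^ 2 + 1) * (h * (ε / K))) = ε * h := by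
    rw [← mul_assoc, ← hK]
    field_simp
  have y9 : 0 ≤ ∫ t in a..b, ‖evalL 0 (Ψ (t + h)) - evalL 0 (Ψ t)‖ ^ 2 :=
    intervalIntegral.integral_nonneg hab fun t _ => by positivity
  linarith

end WeakSolution

/-! ### Steklov averages and conservation of energy -/

theorem intervalIntegral_swap_of_continuous {k : ℝ → ℝ → ℝ} (hk : Continuous k.uncurry)
    {a b c d : ℝ} (hab : a ≤ b) (hcd : c ≤ d) :
    ∫ x in a..b, ∫ y in c..d, k x y = ∫ y in c..d, ∫ x in a..b, k x y := by
  simp only [intervalIntegral.integral_of_le hab, intervalIntegral.integral_of_le hcd]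
  refine integral_integral_swap ?_
  rw [Measure.prod_restrict]
  exact (hk.continuousOn.integrableOn_compact (isCompact_Icc.prod isCompact_Icc)).mono_set
    (Set.prod_mono Set.Ioc_subset_Icc_self Set.Ioc_subset_Icc_self)

section Gradient

variable {U : ℂ → ℝ} {F : ℂ → ℂ}

theorem hasFDerivAt_of_neg_gradient (hU : ContDiff ℝ 2 U) (hF : ∀ z, F z = -gradient U z) (z : ℂ) :
    HasFDerivAt U (-(innerSL ℝ (F z))) z := by
  have h := (hU.differentiable (by norm_num) z).hasGradientAt.hasFDerivAt
  refine h.congr_fderiv ?_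
  rw [hF, map_neg, neg_neg]
  rfl

theorem contDiff_of_neg_gradient (hU : ContDiff ℝ 2 U) (hF : ∀ z, F z = -gradient U z) :
    ContDiff ℝ 1 F := by
  have h : F = fun z => -(InnerProductSpace.toDual ℝ ℂ).symm (fderiv ℝ U z) := funext hF
  rw [h]
  exact ((InnerProductSpace.toDual ℝ ℂ).symm.contDiff.comp (hU.fderiv_right (by norm_num))).neg

theorem real_inner_eq_re (z w : ℂ) : inner ℝ z w = (inner ℂ z w).re := by
  rw [Complex.inner, RCLike.inner_apply, mul_comm]

/-- The gradient of a rotation invariant potential is radial. -/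
theorem im_mul_conj_eq_zero (hU : ContDiff ℝ 2 U) (hF : ∀ z, F z = -gradient U z) {u : ℝ → ℝ}
    (hu : ∀ z, U z = u (‖z‖ ^ 2)) (z : ℂ) : (F z * conj z).im = 0 := by
  -- `U` is constant along the orbit of `z` under rotations, so its gradient is orthogonal to the
  -- tangent `i z`.
  have h1 : HasDerivAt (fun s : ℝ => Complex.exp (s * Complex.I) * z) (Complex.I * z) 0 := by
    have h : HasDerivAt (fun s : ℝ => (s : ℂ) * Complex.I) (1 * Complex.I) 0 :=
      Complex.ofRealCLM.hasDerivAt.mul_const Complex.I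
    have := h.cexp.mul_const z
    simpa using this
  have h2 : HasDerivAt (fun s : ℝ => U (Complex.exp (s * Complex.I) * z))
      (-(inner ℝ (F z) (Complex.I * z))) 0 := by
    have h0 : HasFDerivAt U (-(innerSL ℝ (F z)))
        ((fun s : ℝ => Complex.exp (s * Complex.I) * z) 0) := by
      simpa using hasFDerivAt_of_neg_gradient hU hF z
    exact h0.comp_hasDerivAt 0 h1
  have h3 : (fun s : ℝ => U (Complex.exp (s * Complex.I) * z)) = fun _ => U z := by
    ext s
    rw [hu, hu, norm_mul, Complex.norm_exp_ofReal_mul_I, one_mul]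
  rw [h3] at h2
  have h4 := h2.unique (hasDerivAt_const 0 (U z))
  rw [Complex.inner] at h4
  simp only [Complex.mul_re, Complex.mul_im, Complex.conj_re, Complex.conj_im, Complex.I_re,
    Complex.I_im] at h4 ⊢
  linarith

end Gradient

/-- Commuting a Lipschitz function with an average costs at most the mean oscillation. -/
theorem norm_average_comp_sub_le {y : ℝ → ℂ} (hy : Continuous y) {F : ℂ → ℂ} (hF : Continuous F)
    {t h L M : ℝ} (hh : 0 < h) (hL0 : 0 ≤ L) (hM : ∀ s ∈ Set.Icc t (t + h), ‖y s‖ ≤ M)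
    (hL : ∀ z w, ‖z‖ ≤ M → ‖w‖ ≤ M → ‖F z - F w‖ ≤ L * ‖z - w‖) :
    ‖h⁻¹ • (∫ s in t..(t + h), F (y s)) - F (h⁻¹ • ∫ s in t..(t + h), y s)‖ ≤
      2 * L * h⁻¹ * ∫ r in (0 : ℝ)..h, ‖y (t + r) - y t‖ := by
  set Y := h⁻¹ • ∫ s in t..(t + h), y s with hY
  set D := ∫ r in (0 : ℝ)..h, ‖y (t + r) - y t‖ with hD
  have hle : t ≤ t + h := by linarith
  have avg_sub : ∀ (g : ℝ → ℂ) (c : ℂ), Continuous g →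
      h⁻¹ • (∫ s in t..(t + h), (g s - c)) = h⁻¹ • (∫ s in t..(t + h), g s) - c := by
    intro g c hg
    rw [intervalIntegral.integral_sub (hg.intervalIntegrable _ _) (by simp), smul_sub,
      intervalIntegral.integral_const, add_sub_cancel_left, smul_smul, inv_mul_cancel₀ hh.ne',
      one_smul]
  have hDs : ∫ s in t..(t + h), ‖y s - y t‖ = D := by
    rw [hD, intervalIntegral.integral_comp_add_left (fun s => ‖y s - y t‖), add_zero]
  have hYt : ‖Y - y t‖ ≤ h⁻¹ * D := by
    rw [hY, ← avg_sub y _ hy, norm_smul, norm_inv, Real.norm_of_nonneg hh.le, ← hDs]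
    exact mul_le_mul_of_nonneg_left (intervalIntegral.norm_integral_le_integral_norm hle)
      (by positivity)
  have hYM : ‖Y‖ ≤ M := by
    rw [hY, norm_smul, norm_inv, Real.norm_of_nonneg hh.le]
    have := mul_le_mul_of_nonneg_left (norm_integral_window_le hh.le hM) (inv_nonneg.mpr hh.le)
    rwa [mul_comm M h, inv_mul_cancel_left₀ hh.ne'] at this
  have hyn : Continuous fun s => ‖y s - y t‖ := (hy.sub continuous_const).norm
  have h1 : ∫ s in t..(t + h), ‖F (y s) - F Y‖ ≤
      ∫ s in t..(t + h), L * (‖y s - y t‖ + h⁻¹ * D) := by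
    refine intervalIntegral.integral_mono_on hle
      (((hF.comp hy).sub continuous_const).norm.intervalIntegrable _ _)
      ((continuous_const.mul (hyn.add continuous_const)).intervalIntegrable _ _) fun s hs => ?_
    refine (hL _ _ (hM s hs) hYM).trans (mul_le_mul_of_nonneg_left ?_ hL0)
    have h2 : ‖y s - Y‖ ≤ ‖y s - y t‖ + ‖y t - Y‖ := norm_sub_le_norm_sub_add_norm_sub _ _ _
    rw [norm_sub_rev (y t) Y] at h2
    linarith
  have h3 : ∫ s in t..(t + h), L * (‖y s - y t‖ + h⁻¹ * D) = 2 * L * D := by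
    rw [intervalIntegral.integral_const_mul, intervalIntegral.integral_add
      (hyn.intervalIntegrable _ _) (by simp), hDs, intervalIntegral.integral_const,
      add_sub_cancel_left, smul_eq_mul, mul_inv_cancel_left₀ hh.ne']
    ring
  calc _ = ‖h⁻¹ • ∫ s in t..(t + h), (F (y s) - F Y)‖ := by
        rw [avg_sub (fun s => F (y s)) _ (hF.comp hy)]
    _ ≤ h⁻¹ * ∫ s in t..(t + h), ‖F (y s) - F Y‖ := by
        rw [norm_smul, norm_inv, Real.norm_of_nonneg hh.le]
        exact mul_le_mul_of_nonneg_left (intervalIntegral.norm_integral_le_integral_norm hle)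
          (by positivity)
    _ ≤ h⁻¹ * (2 * L * D) := mul_le_mul_of_nonneg_left (h1.trans_eq h3) (by positivity)
    _ = _ := by ring

theorem tendsto_average {E : Type*} [NormedAddCommGroup E] [NormedSpace ℝ E] [CompleteSpace E]
    {p : ℝ → E} (hp : Continuous p) (t : ℝ) :
    Filter.Tendsto (fun h : ℝ => h⁻¹ • ∫ r in t..(t + h), p r) (nhdsWithin 0 (Set.Ioi 0))
      (nhds (p t)) := by
  have h := hasDerivAt_iff_tendsto_slope_zero.mp (hasDerivAt_integral_zero_self hp t t)
  simp only [intervalIntegral.integral_same, sub_zero] at h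
  exact h.mono_left (nhdsWithin_mono _ fun x (hx : 0 < x) => hx.ne')

theorem hasDerivAt_half_norm_sq {E : Type*} [NormedAddCommGroup E] [InnerProductSpace ℂ E]
    {p : ℝ → E} {p' : E} {t : ℝ} (hp : HasDerivAt p p' t) :
    HasDerivAt (fun s => ‖p s‖ ^ 2 / 2) (inner ℂ (p t) p').re t := by
  have h1 : (fun s => ‖p s‖ ^ 2 / 2) = fun s => (inner ℂ (p s) (p s)).re / 2 := by
    ext s
    rw [inner_self_eq_ofReal, Complex.ofReal_re]
  rw [h1]
  have h2 := (Complex.reCLM.hasFDerivAt.comp_hasDerivAt t (hp.inner ℂ hp)).div_const 2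
  refine h2.congr_deriv ?_
  rw [Complex.reCLM_apply, Complex.add_re, ← inner_conj_symm p' (p t), Complex.conj_re]
  ring

theorem re_inner_smul_smul {E : Type*} [NormedAddCommGroup E] [InnerProductSpace ℂ E]
    [NormedSpace ℝ E] [IsScalarTower ℝ ℂ E] (r : ℝ) (x z : E) :
    (inner ℂ (r • x) (r • z)).re = r * (r * (inner ℂ x z).re) := by
  rw [← algebraMap_smul ℂ r x, ← algebraMap_smul ℂ r z, inner_smul_left, inner_smul_right,
    Complex.coe_algebraMap, Complex.conj_ofReal, Complex.re_ofReal_mul, Complex.re_ofReal_mul]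

/-- Bound of the mean product of two increments of a continuous function by its mean square
increments. -/
theorem integral_product_increments_le {y : ℝ → ℂ} (hy : Continuous y) {a b h K : ℝ} (hab : a ≤ b)
    (hh : 0 < h) (hK : ∀ r, 0 ≤ r → r ≤ h → ∫ t in a..b, ‖y (t + r) - y t‖ ^ 2 ≤ K) :
    ∫ t in a..b, (∫ r in (0 : ℝ)..h, ‖y (t + r) - y t‖) * ‖y (t + h) - y t‖ ≤ h * K := by
  have c1 : Continuous fun p : ℝ × ℝ => ‖y (p.1 + p.2) - y p.1‖ :=
    ((hy.comp (continuous_fst.add continuous_snd)).sub (hy.comp continuous_fst)).norm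
  have c1' : ∀ t, Continuous fun r => ‖y (t + r) - y t‖ := fun t =>
    c1.comp (Continuous.prodMk_right t)
  have c2 : Continuous fun t => ‖y (t + h) - y t‖ := c1.comp (Continuous.prodMk_left h)
  have c3 : Continuous fun p : ℝ × ℝ =>
      (‖y (p.1 + p.2) - y p.1‖ ^ 2 + ‖y (p.1 + h) - y p.1‖ ^ 2) / 2 :=
    ((c1.pow 2).add ((c2.comp continuous_fst).pow 2)).div_const 2
  have c3' : ∀ t, Continuous fun r => (‖y (t + r) - y t‖ ^ 2 + ‖y (t + h) - y t‖ ^ 2) / 2 :=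
    fun t => c3.comp (Continuous.prodMk_right t)
  have c4 : Continuous fun t => ∫ r in (0 : ℝ)..h, ‖y (t + r) - y t‖ :=
    intervalIntegral.continuous_parametric_intervalIntegral_of_continuous'
      (f := fun t r => ‖y (t + r) - y t‖) c1 0 h
  have c5 : Continuous fun t => ∫ r in (0 : ℝ)..h,
      (‖y (t + r) - y t‖ ^ 2 + ‖y (t + h) - y t‖ ^ 2) / 2 :=
    intervalIntegral.continuous_parametric_intervalIntegral_of_continuous'
      (f := fun t r => (‖y (t + r) - y t‖ ^ 2 + ‖y (t + h) - y t‖ ^ 2) / 2) c3 0 h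
  have c6 : Continuous fun r => ∫ t in a..b,
      (‖y (t + r) - y t‖ ^ 2 + ‖y (t + h) - y t‖ ^ 2) / 2 :=
    intervalIntegral.continuous_parametric_intervalIntegral_of_continuous'
      (f := fun r t => (‖y (t + r) - y t‖ ^ 2 + ‖y (t + h) - y t‖ ^ 2) / 2)
      (c3.comp continuous_swap) a b
  calc ∫ t in a..b, (∫ r in (0 : ℝ)..h, ‖y (t + r) - y t‖) * ‖y (t + h) - y t‖
      ≤ ∫ t in a..b, ∫ r in (0 : ℝ)..h, (‖y (t + r) - y t‖ ^ 2 + ‖y (t + h) - y t‖ ^ 2) / 2 := by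
        refine intervalIntegral.integral_mono_on hab ((c4.mul c2).intervalIntegrable _ _)
          (c5.intervalIntegrable _ _) fun t _ => ?_
        rw [← intervalIntegral.integral_mul_const]
        refine intervalIntegral.integral_mono_on hh.le
          (((c1' t).mul continuous_const).intervalIntegrable _ _)
          ((c3' t).intervalIntegrable _ _) fun r _ => ?_
        -- From `2 p q ≤ p² + q²`; after exchanging the integrals, both squares fall under `hK`.
        nlinarith [sq_nonneg (‖y (t + r) - y t‖ - ‖y (t + h) - y t‖)]
    _ = ∫ r in (0 : ℝ)..h, ∫ t in a..b, (‖y (t + r) - y t‖ ^ 2 + ‖y (t + h) - y t‖ ^ 2) / 2 :=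
        intervalIntegral_swap_of_continuous
          (k := fun t r => (‖y (t + r) - y t‖ ^ 2 + ‖y (t + h) - y t‖ ^ 2) / 2) c3 hab hh.le
    _ ≤ ∫ _ in (0 : ℝ)..h, K := by
        refine intervalIntegral.integral_mono_on hh.le (c6.intervalIntegrable _ _) (by simp)
          fun r hr => ?_
        have i1 : Continuous fun t => ‖y (t + r) - y t‖ ^ 2 :=
          (c1.comp (Continuous.prodMk_left r)).pow 2
        have i2 : Continuous fun t => ‖y (t + h) - y t‖ ^ 2 := c2.pow 2
        rw [intervalIntegral.integral_div, intervalIntegral.integral_add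
          (i1.intervalIntegrable _ _) (i2.intervalIntegrable _ _)]
        linarith [hK r hr.1 hr.2, hK h hh.le le_rfl]
    _ = h * K := by
        rw [intervalIntegral.integral_const, sub_zero, smul_eq_mul]

namespace WeakSolution

variable {Ψ : ℝ → H1} {f : ℝ → ℂ} {U : ℂ → ℝ} {F : ℂ → ℂ}

/-- Evolution of the energy of the Steklov averages of a weak solution. -/
theorem hasDerivAt_averaged_energy (H : WeakSolution Ψ f)
    (hU : ∀ z, HasFDerivAt U (-(innerSL ℝ (F z))) z) {h : ℝ} (t : ℝ) :
    HasDerivAt (fun s => ‖h⁻¹ • ∫ r in s..(s + h), derL (Ψ r)‖ ^ 2 / 2 +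
        U (h⁻¹ • ∫ r in s..(s + h), evalL 0 (Ψ r)))
      (inner ℂ (h⁻¹ • (∫ r in t..(t + h), f r) - F (h⁻¹ • ∫ r in t..(t + h), evalL 0 (Ψ r)))
        (h⁻¹ • (evalL 0 (Ψ (t + h)) - evalL 0 (Ψ t)))).re t := by
  have d1 := hasDerivAt_half_norm_sq (p := fun s => h⁻¹ • ∫ r in s..(s + h), derL (Ψ r))
    ((hasDerivAt_integral_window H.continuous_der h t).const_smul h⁻¹)
  have d2 := (hU (h⁻¹ • ∫ r in t..(t + h), evalL 0 (Ψ r))).comp_hasDerivAt t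
    ((hasDerivAt_integral_window H.continuous_trace h t).const_smul h⁻¹)
  refine (d1.add d2).congr_deriv ?_
  -- The kinetic part changes at rate `h⁻² Re ⟨P, P'⟩`, with `P` the time integral over the window.
  -- The equation turns this into the source paired with the trace increment, leaving only the
  -- commutator of `F` with averaging.
  have h1 := H.re_inner_increment t (t + h)
  rw [re_inner_smul_smul, h1, inner_sub_left, Complex.sub_re, re_inner_smul_smul]
  change _ + -(inner ℝ (F (h⁻¹ • ∫ r in t..(t + h), evalL 0 (Ψ r)))
    (h⁻¹ • (evalL 0 (Ψ (t + h)) - evalL 0 (Ψ t)))) = _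
  rw [real_inner_eq_re]
  ring

/-- Conservation of energy. -/
theorem energy_eq (H : WeakSolution Ψ f) (hU : ∀ z, HasFDerivAt U (-(innerSL ℝ (F z))) z)
    (hF : ContDiff ℝ 1 F) (hf : ∀ t, f t = F (evalL 0 (Ψ t))) {a b : ℝ} (hab : a ≤ b) :
    ‖derL (Ψ b)‖ ^ 2 / 2 + U (evalL 0 (Ψ b)) = ‖derL (Ψ a)‖ ^ 2 / 2 + U (evalL 0 (Ψ a)) := by
  set y : ℝ → ℂ := fun t => evalL 0 (Ψ t) with hy
  have hyc : Continuous y := H.continuous_trace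
  have hUc : Continuous U := continuous_iff_continuousAt.mpr fun z => (hU z).continuousAt
  -- The windows reach past `b` by `h < 1`, hence the interval up to `b + 1`.
  obtain ⟨M, hM⟩ := (isCompact_Icc (a := a) (b := b + 1)).exists_bound_of_continuousOn
    hyc.continuousOn
  obtain ⟨L, hL⟩ := hF.contDiffOn.exists_lipschitzOnWith (by decide)
    (convex_closedBall (0 : ℂ) M) (isCompact_closedBall _ _)
  have hL' : ∀ z w, ‖z‖ ≤ M → ‖w‖ ≤ M → ‖F z - F w‖ ≤ L * ‖z - w‖ := fun z w hz hw =>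
    hL.norm_sub_le (mem_closedBall_zero_iff.mpr hz) (mem_closedBall_zero_iff.mpr hw)
  have hLs : ∀ s ∈ Set.Icc a (b + 1), ∀ t ∈ Set.Icc a (b + 1),
      ‖f s - f t‖ ≤ L * ‖evalL 0 (Ψ s) - evalL 0 (Ψ t)‖ := fun s hs t ht => by
    rw [hf, hf]
    exact hL' _ _ (hM s hs) (hM t ht)
  set E : ℝ → ℝ → ℝ := fun h s => ‖h⁻¹ • ∫ r in s..(s + h), derL (Ψ r)‖ ^ 2 / 2 +
    U (h⁻¹ • ∫ r in s..(s + h), y r) with hE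
  have hlim : ∀ t, Filter.Tendsto (fun h => E h t) (nhdsWithin 0 (Set.Ioi 0))
      (nhds (‖derL (Ψ t)‖ ^ 2 / 2 + U (y t))) := fun t =>
    (((tendsto_average H.continuous_der t).norm.pow 2).div_const 2).add
      ((hUc.tendsto _).comp (tendsto_average hyc t))
  have bound : ∀ ε : ℝ, 0 < ε →
      |(‖derL (Ψ b)‖ ^ 2 / 2 + U (y b)) - (‖derL (Ψ a)‖ ^ 2 / 2 + U (y a))| ≤ 2 * L * ε := by
    intro ε hε
    obtain ⟨δ, hδ0, hδ1, hδ⟩ := H.integral_trace_increment_isLittleO hab hLs hε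
    refine le_of_tendsto ((hlim b).sub (hlim a)).abs ?_
    filter_upwards [Ioo_mem_nhdsGT hδ0] with h hh
    have h0 : 0 < h := hh.1
    set D : ℝ → ℝ := fun t => (inner ℂ (h⁻¹ • (∫ r in t..(t + h), f r) -
      F (h⁻¹ • ∫ r in t..(t + h), y r)) (h⁻¹ • (y (t + h) - y t))).re with hD
    have cG : Continuous fun t => h⁻¹ • (∫ r in t..(t + h), f r) :=
      continuous_iff_continuousAt.mpr fun t =>
        ((hasDerivAt_integral_window H.continuous_source h t).const_smul h⁻¹).continuousAt
    have cY : Continuous fun t => h⁻¹ • (∫ r in t..(t + h), y r) :=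
      continuous_iff_continuousAt.mpr fun t =>
        ((hasDerivAt_integral_window hyc h t).const_smul h⁻¹).continuousAt
    have cy : Continuous fun t => y (t + h) - y t :=
      (hyc.comp (continuous_id.add continuous_const)).sub hyc
    have cF : Continuous fun t => F (h⁻¹ • (∫ r in t..(t + h), y r)) := hF.continuous.comp cY
    have cD : Continuous D :=
      Complex.continuous_re.comp ((cG.sub cF).inner (cy.const_smul h⁻¹))
    have hd : ∀ t, HasDerivAt (E h) (D t) t := fun t => H.hasDerivAt_averaged_energy hU t
    have c4 : Continuous fun t => ∫ r in (0 : ℝ)..h, ‖y (t + r) - y t‖ := by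
      have c1 : Continuous fun p : ℝ × ℝ => ‖y (p.1 + p.2) - y p.1‖ :=
        ((hyc.comp (continuous_fst.add continuous_snd)).sub (hyc.comp continuous_fst)).norm
      exact intervalIntegral.continuous_parametric_intervalIntegral_of_continuous'
        (f := fun t r => ‖y (t + r) - y t‖) c1 0 h
    have hDb : ∀ t ∈ Set.Icc a b, ‖D t‖ ≤ 2 * L * h⁻¹ * h⁻¹ *
        ((∫ r in (0 : ℝ)..h, ‖y (t + r) - y t‖) * ‖y (t + h) - y t‖) := by
      intro t ht
      have h1 := norm_average_comp_sub_le hyc hF.continuous h0 L.coe_nonneg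
        (fun s hs => hM s ⟨ht.1.trans hs.1, by linarith [hs.2, ht.2, hh.2]⟩) hL'
      have h2 : (fun s => F (y s)) = f := funext fun s => (hf s).symm
      rw [h2] at h1
      have h3 := (re_inner_le (h⁻¹ • (∫ r in t..(t + h), f r) -
        F (h⁻¹ • ∫ r in t..(t + h), y r)) (h⁻¹ • (y (t + h) - y t)))
      rw [norm_smul, norm_inv, Real.norm_of_nonneg h0.le] at h3
      refine h3.trans ((mul_le_mul_of_nonneg_right h1 (by positivity)).trans_eq ?_)
      ring
    have hint := intervalIntegral.integral_eq_sub_of_hasDerivAt (fun t _ => hd t)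
      (cD.intervalIntegrable a b)
    rw [← hint]
    have hK : ∀ r, 0 ≤ r → r ≤ h → ∫ t in a..b, ‖y (t + r) - y t‖ ^ 2 ≤ ε * h := by
      intro r hr hrh
      rcases hr.eq_or_lt with rfl | hr
      · simp only [add_zero, sub_self, norm_zero]
        simp only [ne_eq, OfNat.ofNat_ne_zero, not_false_eq_true, zero_pow,
          intervalIntegral.integral_zero]
        positivity
      · exact (hδ r hr (hrh.trans_lt hh.2)).trans (mul_le_mul_of_nonneg_left hrh hε.le)
    rw [← Real.norm_eq_abs]
    -- The factor `h⁻²` comes from the average and the difference quotient. It is cancelled by `h`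
    -- from the integration over increments and `ε h` from hidden regularity, so the bound is
    -- independent of `h` and survives the limit.
    calc ‖∫ t in a..b, D t‖ ≤ ∫ t in a..b, ‖D t‖ :=
          intervalIntegral.norm_integral_le_integral_norm hab
      _ ≤ ∫ t in a..b, 2 * L * h⁻¹ * h⁻¹ *
          ((∫ r in (0 : ℝ)..h, ‖y (t + r) - y t‖) * ‖y (t + h) - y t‖) :=
          intervalIntegral.integral_mono_on hab (cD.norm.intervalIntegrable _ _)
            ((continuous_const.mul (c4.mul cy.norm)).intervalIntegrable _ _) hDb
      _ ≤ 2 * L * h⁻¹ * h⁻¹ * (h * (ε * h)) := by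
          rw [intervalIntegral.integral_const_mul]
          exact mul_le_mul_of_nonneg_left (integral_product_increments_le hyc hab h0 hK)
            (by positivity)
      _ = 2 * L * ε := by
          field_simp
  have hz : |(‖derL (Ψ b)‖ ^ 2 / 2 + U (y b)) - (‖derL (Ψ a)‖ ^ 2 / 2 + U (y a))| ≤ 0 := by
    refine le_of_forall_pos_le_add fun ε hε => ?_
    rw [zero_add]
    have hp : (0 : ℝ) < 2 * L + 1 := by positivity
    refine (bound (ε / (2 * L + 1)) (by positivity)).trans ?_
    rw [mul_div_assoc', div_le_iff₀ hp]
    nlinarith [L.coe_nonneg]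
  exact sub_eq_zero.mp (abs_nonpos_iff.mp hz)

end WeakSolution

/-! ### A priori bounds -/

theorem SolvesNLS.weakSolution {F : ℂ → ℂ} (hF : Continuous F) {ψ : ℝ × ℝ → ℂ}
    (hψ : SolvesNLS F ψ) {Ψ : ℝ → H1} (hΨ : Continuous Ψ)
    (hrep : ∀ t, IsContinuousRep (fun x => ψ (x, t)) (Ψ t)) :
    WeakSolution Ψ fun t => F (evalL 0 (Ψ t)) where
  continuous_path := hΨ
  continuous_source := hF.comp ((evalL 0).continuous.comp hΨ)
  weak Φ a b := by
    rw [hψ.weak_H1 hF hΨ hrep Φ a b, RCLike.inner_apply]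
    simp only [(hrep _).evalL_eq]
    ring

/-- Bound of the derivative by the energy and the charge, for a potential that is bounded below by
`A - B ‖z‖ ^ 2`. -/
theorem IsContinuousRep.norm_derL_sq_le {v : ℝ → ℂ} {Φ : H1} (h : IsContinuousRep v Φ) {x : ℝ}
    {U : ℂ → ℝ} {A B : ℝ} (hB : 0 < B) (hU : A - B * ‖v x‖ ^ 2 ≤ U (v x)) :
    ‖derL Φ‖ ^ 2 ≤ 4 * (‖derL Φ‖ ^ 2 / 2 + U (v x) - A + 16 * B ^ 2 * ‖fnL Φ‖ ^ 2) := by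
  -- The length `(8 B)⁻¹` makes the derivative contribute at most `‖derL Φ‖² / 4` to `B ‖v x‖²`,
  -- half of the kinetic energy.
  have h1 := pow_le_pow_left₀ (by positivity) (h.sqrt_mul_norm_le x (l := (8 * B)⁻¹)
    (by positivity)) 2
  rw [mul_pow, Real.sq_sqrt (by positivity)] at h1
  have h2 : ‖v x‖ ^ 2 ≤ 8 * B * (‖fnL Φ‖ + (8 * B)⁻¹ * ‖derL Φ‖) ^ 2 := by
    rw [inv_mul_le_iff₀ (by positivity)] at h1
    exact h1
  have h3 : B * (8 * B * (‖fnL Φ‖ + (8 * B)⁻¹ * ‖derL Φ‖) ^ 2) ≤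
      16 * B ^ 2 * ‖fnL Φ‖ ^ 2 + ‖derL Φ‖ ^ 2 / 4 := by
    have e : B * (8 * B * (‖fnL Φ‖ + (8 * B)⁻¹ * ‖derL Φ‖) ^ 2) =
        (8 * B * ‖fnL Φ‖ + ‖derL Φ‖) ^ 2 / 8 := by
      field_simp
    rw [e]
    nlinarith [sq_nonneg (8 * B * ‖fnL Φ‖ - ‖derL Φ‖)]
  nlinarith [mul_le_mul_of_nonneg_left h2 hB.le]

namespace WeakSolution

variable {Ψ : ℝ → H1} {f : ℝ → ℂ}

/-- A weak solution that is bounded in `H¹` is Hölder continuous of exponent `1/2` in `L²`. -/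
theorem norm_sq_sub_le_mul (h : WeakSolution Ψ f) {D K M : ℝ} (hD : ∀ t, ‖derL (Ψ t)‖ ≤ D)
    (hK : ∀ t, ‖f t‖ ≤ K) (hM : ∀ t, ‖evalL 0 (Ψ t)‖ ≤ M) (a b : ℝ) :
    ‖fnL (Ψ b) - fnL (Ψ a)‖ ^ 2 ≤ (2 * D ^ 2 + 2 * K * M) * |b - a| := by
  have hD0 : 0 ≤ D := (norm_nonneg _).trans (hD 0)
  have hK0 : 0 ≤ K := (norm_nonneg _).trans (hK 0)
  have i1 : ‖∫ t in a..b, derL (Ψ t)‖ ≤ D * |b - a| :=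
    intervalIntegral.norm_integral_le_of_norm_le_const fun t _ => hD t
  have i2 : ‖∫ t in a..b, f t‖ ≤ K * |b - a| :=
    intervalIntegral.norm_integral_le_of_norm_le_const fun t _ => hK t
  have d1 : ‖derL (Ψ b) - derL (Ψ a)‖ ≤ D + D :=
    (_root_.norm_sub_le _ _).trans (add_le_add (hD b) (hD a))
  have d2 : ‖evalL 0 (Ψ b) - evalL 0 (Ψ a)‖ ≤ M + M :=
    (_root_.norm_sub_le _ _).trans (add_le_add (hM b) (hM a))
  calc _ ≤ _ := h.norm_sq_sub_le a b
    _ ≤ D * |b - a| * (D + D) + K * |b - a| * (M + M) :=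
        add_le_add (mul_le_mul i1 d1 (norm_nonneg _) (by positivity))
          (mul_le_mul i2 d2 (norm_nonneg _) (by positivity))
    _ = _ := by ring

/-- A priori bound in `H¹` from the conservation of charge and energy. -/
theorem exists_norm_derL_le {U : ℂ → ℝ} {F : ℂ → ℂ} (h : WeakSolution Ψ f)
    (hU : ∀ z, HasFDerivAt U (-(innerSL ℝ (F z))) z) (hF : ContDiff ℝ 1 F)
    (hf : ∀ t, f t = F (evalL 0 (Ψ t))) (hc : ∀ a b, ‖fnL (Ψ b)‖ = ‖fnL (Ψ a)‖) {A B : ℝ}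
    (hB : 0 < B) (hAB : ∀ z, A - B * ‖z‖ ^ 2 ≤ U z) : ∃ D, ∀ t, ‖derL (Ψ t)‖ ≤ D := by
  have he : ∀ t, ‖derL (Ψ t)‖ ^ 2 / 2 + U (evalL 0 (Ψ t)) =
      ‖derL (Ψ 0)‖ ^ 2 / 2 + U (evalL 0 (Ψ 0)) := fun t => by
    rcases le_total 0 t with ht | ht
    · exact h.energy_eq hU hF hf ht
    · exact (h.energy_eq hU hF hf ht).symm
  refine ⟨√(4 * (‖derL (Ψ 0)‖ ^ 2 / 2 + U (evalL 0 (Ψ 0)) - A +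
    16 * B ^ 2 * ‖fnL (Ψ 0)‖ ^ 2)), fun t => Real.le_sqrt_of_sq_le ?_⟩
  obtain ⟨v, hv⟩ := exists_isContinuousRep (Ψ t)
  have := hv.norm_derL_sq_le (x := 0) (U := U) hB (hAB _)
  rwa [← hv.evalL_eq, he t, hc 0 t] at this

end WeakSolution

/-! ### Hölder estimates in time and space -/

/-- Interpolation at length `l = √d` balances the two terms: both are of order `√d`, and division by
`√l` leaves the fourth root. -/
theorem IsContinuousRep.norm_le_mul_sqrt_sqrt {v : ℝ → ℂ} {Φ : H1} (h : IsContinuousRep v Φ)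
    {C D d : ℝ} (hC : 0 ≤ C) (hd : 0 < d) (hf : ‖fnL Φ‖ ^ 2 ≤ C * d) (hD : ‖derL Φ‖ ≤ D) (x : ℝ) :
    ‖v x‖ ≤ (√C + D) * √√d := by
  have h1 := h.sqrt_mul_norm_le x (Real.sqrt_pos.mpr hd)
  have h2 : ‖fnL Φ‖ ≤ √C * √d := by
    rw [← Real.sqrt_mul hC]
    exact Real.le_sqrt_of_sq_le hf
  have hq : 0 < √√d := Real.sqrt_pos.mpr (Real.sqrt_pos.mpr hd)
  refine le_of_mul_le_mul_left ?_ hq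
  calc √√d * ‖v x‖ ≤ √C * √d + √d * D :=
        h1.trans (add_le_add h2 (mul_le_mul_of_nonneg_left hD (Real.sqrt_nonneg _)))
    _ = (√C + D) * (√√d * √√d) := by
        rw [Real.mul_self_sqrt (Real.sqrt_nonneg _)]
        ring
    _ = √√d * ((√C + D) * √√d) := by ring

/-- For distances at most 1 the exponent 1/2 from Cauchy-Schwarz is stronger than 1/4; beyond that
the sup bound suffices. -/
theorem IsContinuousRep.norm_sub_le_mul_sqrt_sqrt {v : ℝ → ℂ} {Φ : H1} (h : IsContinuousRep v Φ)
    {D M : ℝ} (hD : ‖derL Φ‖ ≤ D) (hM : ∀ x, ‖v x‖ ≤ M) (a b : ℝ) :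
    ‖v b - v a‖ ≤ (D + 2 * M) * √√|b - a| := by
  have hD0 : 0 ≤ D := (norm_nonneg _).trans hD
  have hM0 : 0 ≤ M := (norm_nonneg _).trans (hM 0)
  rcases le_total √|b - a| 1 with h1 | h1
  · have h2 : √|b - a| ≤ √√|b - a| := Real.le_sqrt_of_sq_le (by
      nlinarith [Real.sqrt_nonneg |b - a|])
    calc ‖v b - v a‖ ≤ √|b - a| * ‖derL Φ‖ := h.norm_sub_le a b
      _ ≤ √√|b - a| * D := mul_le_mul h2 hD (norm_nonneg _) (Real.sqrt_nonneg _)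
      _ ≤ (D + 2 * M) * √√|b - a| := by
        nlinarith [mul_nonneg hM0 (Real.sqrt_nonneg √|b - a|)]
  · have h2 : 1 ≤ √√|b - a| := Real.one_le_sqrt.mpr h1
    have h3 := (_root_.norm_sub_le (v b) (v a)).trans (add_le_add (hM b) (hM a))
    nlinarith [mul_nonneg hD0 (Real.sqrt_nonneg √|b - a|), mul_le_mul_of_nonneg_left h2 hM0]

theorem holderWith_one_fourth_of_norm_sub_le {X : Type*} [PseudoMetricSpace X] {g : X → ℂ}
    {C : ℝ} (hC : 0 ≤ C) (h : ∀ p q, ‖g p - g q‖ ≤ C * √√(dist p q)) :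
    HolderWith C.toNNReal (1 / 4) g := by
  intro p q
  have e : √√(dist p q) = dist p q ^ (1 / 4 : ℝ) := by
    rw [Real.sqrt_eq_rpow, Real.sqrt_eq_rpow, ← Real.rpow_mul dist_nonneg]
    norm_num
  rw [edist_dist, edist_dist, ENNReal.ofReal_rpow_of_nonneg dist_nonneg (NNReal.coe_nonneg _)]
  change _ ≤ ENNReal.ofReal C * _
  rw [← ENNReal.ofReal_mul hC, dist_eq_norm]
  refine ENNReal.ofReal_le_ofReal ((h p q).trans_eq ?_)
  rw [e]
  norm_num

end

theorem theorem2
    (U : ℂ → ℝ) (hU : ContDiff ℝ 2 U)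
    (F : ℂ → ℂ) (hF : ∀ z : ℂ, F z = -gradient U z)
    (u : ℝ → ℝ) (hu : ∀ z : ℂ, U z = u (‖z‖ ^ 2))
    (A B : ℝ) (hB : 0 < B) (hAB : ∀ z : ℂ, A - B * ‖z‖ ^ 2 ≤ U z)
    (φ : H1) (ψ : ℝ × ℝ → ℂ) (hψ : IsGlobalSolution F φ ψ) :
    (∃ M : ℝ, ∀ p : ℝ × ℝ, ‖ψ p‖ ≤ M) ∧
      ∃ C : ℝ≥0, HolderWith C (1 / 4) ψ := by
  obtain ⟨Ψ, hΨ, -, hrep⟩ := hψ.continuous_H1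
  have hF1 := contDiff_of_neg_gradient hU hF
  have H := hψ.equation.weakSolution hF1.continuous hΨ hrep
  have hc := H.norm_fn_eq fun t => im_mul_conj_eq_zero hU hF hu (evalL 0 (Ψ t))
  obtain ⟨D, hD⟩ := H.exists_norm_derL_le (hasFDerivAt_of_neg_gradient hU hF) hF1
    (fun _ => rfl) hc hB hAB
  have hM : ∀ t x, ‖ψ (x, t)‖ ≤ ‖fnL (Ψ 0)‖ + D := fun t x =>
    ((hrep t).norm_le x).trans (add_le_add (hc 0 t).le (hD t))
  set M := ‖fnL (Ψ 0)‖ + D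
  have hM0 : ∀ t, ‖evalL 0 (Ψ t)‖ ≤ M := fun t => by
    rw [(hrep t).evalL_eq]
    exact hM t 0
  -- The trace stays in a fixed ball, so the source is bounded uniformly in time.
  obtain ⟨K, hK⟩ := (isCompact_closedBall (0 : ℂ) M).exists_bound_of_continuousOn
    hF1.continuous.continuousOn
  have hL := H.norm_sq_sub_le_mul hD
    (fun t => hK _ (mem_closedBall_zero_iff.mpr (hM0 t))) hM0
  have hDp : 0 ≤ D := (norm_nonneg _).trans (hD 0)
  have hMp : 0 ≤ M := (norm_nonneg _).trans (hM0 0)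
  have hKp : 0 ≤ K := (norm_nonneg _).trans (hK 0 (by simpa using hMp))
  have htime : ∀ x a b, ‖ψ (x, b) - ψ (x, a)‖ ≤
      (√(2 * D ^ 2 + 2 * K * M) + 2 * D) * √√|b - a| := fun x a b => by
    -- Equal times are set apart because the interpolation length must be positive.
    rcases eq_or_ne b a with rfl | hab
    · simp
    · refine ((hrep b).sub (hrep a)).norm_le_mul_sqrt_sqrt (by positivity)
        (abs_pos.mpr (sub_ne_zero.mpr hab)) ?_ ?_ x
      · rw [map_sub]
        exact hL a b
      · rw [map_sub]
        exact (norm_sub_le _ _).trans (by linarith [hD a, hD b])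
  refine ⟨⟨M, fun p => hM p.2 p.1⟩, _, holderWith_one_fourth_of_norm_sub_le
    (C := √(2 * D ^ 2 + 2 * K * M) + 2 * D + (D + 2 * M)) (by positivity) ?_⟩
  rintro ⟨x, t⟩ ⟨x', t'⟩
  have h1 := htime x t' t
  have h2 := (hrep t').norm_sub_le_mul_sqrt_sqrt (hD t') (hM t') x' x
  -- The distance on the product is the maximum of the two distances.
  have m1 : √√|t - t'| ≤ √√(dist (x, t) (x', t')) :=
    Real.sqrt_le_sqrt (Real.sqrt_le_sqrt (le_max_right (dist x x') (dist t t')))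
  have m2 : √√|x - x'| ≤ √√(dist (x, t) (x', t')) :=
    Real.sqrt_le_sqrt (Real.sqrt_le_sqrt (le_max_left (dist x x') (dist t t')))
  calc ‖ψ (x, t) - ψ (x', t')‖
      ≤ ‖ψ (x, t) - ψ (x, t')‖ + ‖ψ (x, t') - ψ (x', t')‖ := norm_sub_le_norm_sub_add_norm_sub ..
    _ ≤ _ := add_le_add h1 h2
    _ ≤ _ := add_le_add (mul_le_mul_of_nonneg_left m1 (by positivity))
        (mul_le_mul_of_nonneg_left m2 (by positivity))
    _ = _ := by ring
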